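/- Let $\Lambda$ be the $2$-graph with one vertex $v$, two blue edges $f_1,f_2$ (of degree $e_1$), one red edge $e$ (of degree $e_2$), and factorization rules $f_1e=ef_2$ and $ef_1=f_2e$. Its infinite path space $\Lambda^\infty$ (the degree-preserving functors $\Omega_2\to\Lambda$) carries the topology generated by the cylinder sets $Z(\lambda)=\{x: x(0,d(\lambda))=\lambda\}$. The standard prefixing maps are $\sigma_\lambda:Z(s(\lambda))\to\Lambda^\infty$, $\sigma_\lambda(x)=\lambda x$, and the standard coding maps are $\sigma^m(x)(p,q)=x(p+m,q+m)$, $m\in\mathbb N^2$. The Perron–Frobenius measure $M$ on $\Lambda^\infty$ is the Borel measure with $M(Z(\lambda))=\rho(\Lambda)^{-d(\lambda)}\kappa_{s(\lambda)}$, where $\rho(\Lambda)$ is the pair of spectral radii of the vertex matrices and $\kappa$ is the unimodular Perron–Frobenius eigenvector. Let $(\gamma_i)_{i\ge1}$ be real numbers with $|\gamma_i|<\tfrac12$ for all $i$ and $\sum_i|\gamma_i|<\infty$. For $n\ge 0$ and $g_1,\dots,g_n\in\{f_1,f_2\}$ put $$\mu\bigl(Z(eg_1eg_2\cdots eg_n)\bigr)=\prod_{i=1}^n\alpha_i,\qquad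 \alpha_i=\begin{cases}\tfrac12+\gamma_i,& g_i=f_1,\\ \tfrac12-\gamma_i,& g_i=f_2,\end{cases}$$ with the empty product equal to $1$, so that $\mu(Z(v))=1$. Then: (a) The function $\mu$ extends uniquely to a Borel probability measure on $\Lambda^\infty$, and the standard prefixing and coding maps $(\sigma_\lambda,\sigma^m)$ endow $(\Lambda^\infty,\mu)$ with a $\Lambda$-semibranching function system. (b) The Perron–Frobenius measure $M$ exists and is unique, and $\mu$ and $M$ are mutually absolutely continuous. (c) The standard prefixing and coding maps also give a $\Lambda$-semibranching function system on $(\Lambda^\infty,M)$. For $\nu\in\{\mu,M\}$ there is a unique representation $\pi_\nu$ of $C^*(\Lambda)$ on $L^2(\Lambda^\infty,\nu)$ that sends each generator $t_\lambda$ to the operator $$S_\lambda\xi(x)=\chi_{Z(\lambda)}(x)\,\Bigl(\tfrac{d(\nu\circ\sigma_\lambda)}{d\nu}\bigl(\sigma^{d(\lambda)}(x)\bigr)\Bigr)^{-1/2}\,\xi\bigl(\sigma^{d(\lambda)}(x)\bigr),$$ and $\pi_\mu$ is unitarily equivalent to the standard $\Lambda$-semibranching representation $\pi_M$. In particular, the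 representations $\pi_\mu$, for all sequences $(\gamma_i)$ as above, are pairwise unitarily equivalent. -/

import Mathlib

open MeasureTheory Set
open scoped ENNReal

/-- A `k`-graph: a countable small category (objects `Vertex`, morphisms `Path`, range `r`, source
`s`, where `comp a b` is the product `ab`, defined when `s a = r b`) with a degree functor `d` to
`ℕ^k` having the factorization property. -/
structure KGraph (k : ℕ) where
  Vertex : Type
  Path : Type
  countable_path : Countable Path
  r : Path → Vertex
  s : Path → Vertex
  ident : Vertex → Path
  comp : ∀ a b : Path, s a = r b → Path
  r_ident : ∀ v, r (ident v) = v
  s_ident : ∀ v, s (ident v) = v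
  r_comp : ∀ a b h, r (comp a b h) = r a
  s_comp : ∀ a b h, s (comp a b h) = s b
  ident_comp : ∀ a, comp (ident (r a)) a (s_ident (r a)) = a
  comp_ident : ∀ a, comp a (ident (s a)) (r_ident (s a)).symm = a
  assoc : ∀ a b c (hab : s a = r b) (hbc : s b = r c),
    comp (comp a b hab) c ((s_comp a b hab).trans hbc) =
      comp a (comp b c hbc) (hab.trans (r_comp b c hbc).symm)
  d : Path → (Fin k → ℕ)
  d_ident : ∀ v, d (ident v) = 0
  d_comp : ∀ a b h, d (comp a b h) = d a + d b
  factorization : ∀ (a : Path) (m n : Fin k → ℕ), d a = m + n →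
    ∃! p : Path × Path, (∃ h : s p.1 = r p.2, comp p.1 p.2 h = a) ∧ d p.1 = m ∧ d p.2 = n

namespace KGraph

variable {k : ℕ} (Λ : KGraph k)

/-- An infinite path: a degree-preserving functor `Ω_k → Λ`. The morphism `(p, q)` of `Ω_k`
(`p ≤ q` in `ℕ^k`, with range `p`, source `q` and degree `q - p`) is sent to `toFun p q`. -/
@[ext]
structure InfPath where
  vertex : (Fin k → ℕ) → Λ.Vertex
  toFun : ∀ p q : Fin k → ℕ, p ≤ q → Λ.Path
  r_toFun : ∀ p q h, Λ.r (toFun p q h) = vertex p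
  s_toFun : ∀ p q h, Λ.s (toFun p q h) = vertex q
  map_id : ∀ p, toFun p p le_rfl = Λ.ident (vertex p)
  map_comp : ∀ p q t (hpq : p ≤ q) (hqt : q ≤ t),
    Λ.comp (toFun p q hpq) (toFun q t hqt) ((s_toFun p q hpq).trans (r_toFun q t hqt).symm) =
      toFun p t (hpq.trans hqt)
  d_toFun : ∀ p q h, Λ.d (toFun p q h) = q - p

/-- The cylinder set `Z(a) = {x : x(0, d(a)) = a}`. -/
def cylinder (a : Λ.Path) : Set Λ.InfPath := {x | x.toFun 0 (Λ.d a) zero_le = a}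

/-- The topology on `Λ^∞` generated by the cylinder sets. -/
instance : TopologicalSpace Λ.InfPath :=
  TopologicalSpace.generateFrom (Set.range Λ.cylinder)

instance : MeasurableSpace Λ.InfPath := borel _

instance : BorelSpace Λ.InfPath := ⟨rfl⟩

/-- The coding map `σ^m`, `σ^m(x)(p, q) = x(p + m, q + m)`. -/
def shift (m : Fin k → ℕ) (x : Λ.InfPath) : Λ.InfPath where
  vertex p := x.vertex (p + m)
  toFun p q h := x.toFun (p + m) (q + m) (by gcongr)
  r_toFun _ _ _ := x.r_toFun _ _ _
  s_toFun _ _ _ := x.s_toFun _ _ _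
  map_id _ := x.map_id _
  map_comp _ _ _ _ _ := x.map_comp _ _ _ _ _
  d_toFun p q h := by rw [x.d_toFun, add_tsub_add_eq_tsub_right]

section Factor

variable {Λ}

theorem factor_exists (a : Λ.Path) (m : Fin k → ℕ) (hm : m ≤ Λ.d a) :
    ∃ p : Λ.Path × Λ.Path, (∃ h : Λ.s p.1 = Λ.r p.2, Λ.comp p.1 p.2 h = a) ∧
      Λ.d p.1 = m ∧ Λ.d p.2 = Λ.d a - m :=
  (Λ.factorization a m (Λ.d a - m) (add_tsub_cancel_of_le hm).symm).exists

/-- The initial segment `a(0, m)`. -/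
noncomputable def head (a : Λ.Path) (m : Fin k → ℕ) (hm : m ≤ Λ.d a) : Λ.Path :=
  (Classical.choose (factor_exists a m hm)).1

/-- The final segment `a(m, d(a))`. -/
noncomputable def tail (a : Λ.Path) (m : Fin k → ℕ) (hm : m ≤ Λ.d a) : Λ.Path :=
  (Classical.choose (factor_exists a m hm)).2

theorem s_head (a : Λ.Path) (m : Fin k → ℕ) (hm : m ≤ Λ.d a) :
    Λ.s (head a m hm) = Λ.r (tail a m hm) :=
  (Classical.choose_spec (factor_exists a m hm)).1.1

theorem head_comp_tail (a : Λ.Path) (m : Fin k → ℕ) (hm : m ≤ Λ.d a) :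
    Λ.comp (head a m hm) (tail a m hm) (s_head a m hm) = a :=
  (Classical.choose_spec (factor_exists a m hm)).1.2

theorem d_head (a : Λ.Path) (m : Fin k → ℕ) (hm : m ≤ Λ.d a) : Λ.d (head a m hm) = m :=
  (Classical.choose_spec (factor_exists a m hm)).2.1

theorem d_tail (a : Λ.Path) (m : Fin k → ℕ) (hm : m ≤ Λ.d a) :
    Λ.d (tail a m hm) = Λ.d a - m :=
  (Classical.choose_spec (factor_exists a m hm)).2.2

theorem comp_unique (b c b' c' : Λ.Path) (h : Λ.s b = Λ.r c) (h' : Λ.s b' = Λ.r c')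
    (he : Λ.comp b c h = Λ.comp b' c' h') (hd : Λ.d b = Λ.d b') : b = b' ∧ c = c' := by
  have h1 := Λ.d_comp b c h
  have h2 := Λ.d_comp b' c' h'
  have h3 : Λ.d c' = Λ.d c := by
    rw [he, h2, hd] at h1
    exact add_left_cancel h1
  have := (Λ.factorization (Λ.comp b c h) (Λ.d b) (Λ.d c) h1).unique
    (y₁ := (b, c)) (y₂ := (b', c')) ⟨⟨h, rfl⟩, rfl, rfl⟩ ⟨⟨h', he.symm⟩, hd.symm, h3⟩
  exact ⟨congrArg Prod.fst this, congrArg Prod.snd this⟩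

variable (a : Λ.Path) (x : Λ.InfPath) (hx : Λ.s a = x.vertex 0)

/-- The finite path `a x(0, q)`, of degree `d(a) + q`. -/
def prefixPath (q : Fin k → ℕ) : Λ.Path :=
  Λ.comp a (x.toFun 0 q zero_le) (hx.trans (x.r_toFun _ _ _).symm)

theorem le_d_prefixPath (q : Fin k → ℕ) : q ≤ Λ.d (prefixPath a x hx q) := by
  rw [prefixPath, Λ.d_comp, x.d_toFun, tsub_zero]
  exact le_add_self

/-- `(a x)(0, q)`. -/
noncomputable def prefixHead (q : Fin k → ℕ) : Λ.Path :=
  head (prefixPath a x hx q) q (le_d_prefixPath a x hx q)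

theorem d_prefixHead (q : Fin k → ℕ) : Λ.d (prefixHead a x hx q) = q := d_head _ _ _

/-- `(a x)(p, q)`: the segment of the finite path `a x(0, q)` between `p` and `q`. -/
noncomputable def prefixSeg (p q : Fin k → ℕ) (h : p ≤ q) : Λ.Path :=
  tail (prefixHead a x hx q) p (h.trans_eq (d_prefixHead a x hx q).symm)

theorem prefixHead_eq (p q : Fin k → ℕ) (h : p ≤ q) :
    ∃ e : Λ.s (prefixHead a x hx p) = Λ.r (prefixSeg a x hx p q h),
      Λ.comp (prefixHead a x hx p) (prefixSeg a x hx p q h) e = prefixHead a x hx q := by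
  have hp : p ≤ Λ.d (prefixHead a x hx q) := h.trans_eq (d_prefixHead a x hx q).symm
  have key : head (prefixHead a x hx q) p hp = prefixHead a x hx p := by
    have e1 := head_comp_tail (prefixPath a x hx p) p (le_d_prefixPath a x hx p)
    have e2 := head_comp_tail (prefixPath a x hx q) q (le_d_prefixPath a x hx q)
    have e3 := head_comp_tail (prefixHead a x hx q) p hp
    have s1 := s_head (prefixPath a x hx p) p (le_d_prefixPath a x hx p)
    have s2 := s_head (prefixPath a x hx q) q (le_d_prefixPath a x hx q)
    have s3 := s_head (prefixHead a x hx q) p hp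
    change Λ.s (prefixHead a x hx p) = _ at s1
    change Λ.s (prefixHead a x hx q) = _ at s2
    have hs : Λ.s (prefixPath a x hx p) = Λ.r (x.toFun p q h) := by
      rw [prefixPath, Λ.s_comp, x.s_toFun, x.r_toFun]
    have e4 : prefixPath a x hx q = Λ.comp (prefixPath a x hx p) (x.toFun p q h) hs := by
      simp only [prefixPath]
      rw [Λ.assoc _ _ _ _ ((x.s_toFun _ _ _).trans (x.r_toFun _ _ _).symm)]
      congr 1
      exact (x.map_comp _ _ _ _ _).symm
    have t1 : Λ.s (tail (prefixPath a x hx p) p (le_d_prefixPath a x hx p)) =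
        Λ.r (x.toFun p q h) := by
      rw [← hs]
      conv_rhs => rw [← e1, Λ.s_comp]
    have t3 : Λ.s (tail (prefixHead a x hx q) p hp) =
        Λ.r (tail (prefixPath a x hx q) q (le_d_prefixPath a x hx q)) := by
      rw [← s2]
      conv_rhs => rw [← e3, Λ.s_comp]
    refine (comp_unique _ (Λ.comp _ _ t3) _ (Λ.comp _ _ t1) (s3.trans (Λ.r_comp _ _ _).symm)
      (s1.trans (Λ.r_comp _ _ _).symm) ?_ ?_).1
    · rw [← Λ.assoc _ _ _ s3 t3, ← Λ.assoc _ _ _ s1 t1]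
      trans prefixPath a x hx q
      · refine Eq.trans ?_ e2
        congr 1
      · rw [e4]
        congr 1
        exact e1.symm
    · rw [d_head, d_prefixHead]
  refine ⟨?_, ?_⟩
  · rw [← key]; exact s_head _ _ _
  · have := head_comp_tail (prefixHead a x hx q) p hp
    conv_rhs => rw [← this]
    congr 1
    exact key.symm

/-- The infinite path `a x`. -/
noncomputable def prefixed : Λ.InfPath where
  vertex p := Λ.s (prefixHead a x hx p)
  toFun p q h := prefixSeg a x hx p q h
  r_toFun p q h := (prefixHead_eq a x hx p q h).1.symm
  s_toFun p q h := by
    obtain ⟨e, he⟩ := prefixHead_eq a x hx p q h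
    rw [← he, Λ.s_comp]
  map_id p := by
    obtain ⟨e, he⟩ := prefixHead_eq a x hx p p le_rfl
    refine (comp_unique _ _ _ _ e (Λ.r_ident _).symm ?_ rfl).2
    rw [he, Λ.comp_ident]
  map_comp p q t hpq hqt := by
    obtain ⟨e1, h1⟩ := prefixHead_eq a x hx p q hpq
    obtain ⟨e2, h2⟩ := prefixHead_eq a x hx q t hqt
    obtain ⟨e3, h3⟩ := prefixHead_eq a x hx p t (hpq.trans hqt)
    have e4 : Λ.s (prefixSeg a x hx p q hpq) = Λ.r (prefixSeg a x hx q t hqt) := by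
      rw [← e2]
      conv_rhs => rw [← h1, Λ.s_comp]
    refine (comp_unique _ _ _ _ (e1.trans (Λ.r_comp _ _ e4).symm) e3 ?_ rfl).2
    rw [← Λ.assoc _ _ _ e1 e4, h3]
    conv_rhs => rw [← h2]
    congr 1
  d_toFun p q h := by rw [prefixSeg, d_tail, d_prefixHead]

end Factor

/-- The domain `D_a = Z(s(a))`. -/
def prefixDomain (a : Λ.Path) : Set Λ.InfPath := Λ.cylinder (Λ.ident (Λ.s a))

theorem source_eq_of_mem_prefixDomain {a : Λ.Path} {x : Λ.InfPath} (hx : x ∈ Λ.prefixDomain a) :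
    Λ.s a = x.vertex 0 := by
  have h : x.toFun 0 (Λ.d (Λ.ident (Λ.s a))) zero_le = Λ.ident (Λ.s a) := hx
  have h2 := congrArg Λ.r h
  rw [x.r_toFun, Λ.r_ident] at h2
  exact h2.symm

/-- The prefixing map `σ_a : Z(s(a)) → Λ^∞`, `x ↦ a x`. -/
noncomputable def prefixMap (a : Λ.Path) (x : Λ.prefixDomain a) : Λ.InfPath :=
  prefixed a x.1 (Λ.source_eq_of_mem_prefixDomain x.2)

section PerronFrobenius

variable [Fintype Λ.Vertex] [DecidableEq Λ.Vertex]

/-- `|vΛ^{e_i}w|`. -/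
noncomputable def edgeCount (i : Fin k) (v w : Λ.Vertex) : ℕ :=
  Nat.card {a : Λ.Path // Λ.d a = Pi.single i 1 ∧ Λ.r a = v ∧ Λ.s a = w}

/-- The spectral radius `ρ_i` of the vertex matrix `A_i`. -/
noncomputable def rho (i : Fin k) : ℝ :=
  (spectralRadius ℂ (Matrix.of fun v w => (Λ.edgeCount i v w : ℂ))).toReal

/-- `κ` is the unimodular Perron–Frobenius eigenvector of `Λ`. -/
structure IsPerronFrobeniusVector (κ : Λ.Vertex → ℝ) : Prop where
  pos : ∀ v, 0 < κ v
  sum_eq_one : ∑ v, κ v = 1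
  eigen : ∀ i, (Matrix.of fun v w => (Λ.edgeCount i v w : ℝ)).mulVec κ = Λ.rho i • κ

/-- `M` is the Perron–Frobenius measure: `M(Z(a)) = ρ(Λ)^{-d(a)} κ_{s(a)}` for all `a`. -/
def IsPerronFrobeniusMeasure (M : Measure Λ.InfPath) : Prop :=
  ∃ κ, Λ.IsPerronFrobeniusVector κ ∧
    ∀ a, M (Λ.cylinder a) = ENNReal.ofReal ((∏ i, Λ.rho i ^ Λ.d a i)⁻¹ * κ (Λ.s a))

end PerronFrobenius

/-- A Cuntz–Krieger `Λ`-family (for row-finite `Λ` without sources) in a star-algebra. -/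
structure IsCuntzKrieger {B : Type*} [NonUnitalSemiring B] [Star B] (t : Λ.Path → B) : Prop where
  projection : ∀ v, IsStarProjection (t (Λ.ident v))
  orthogonal : ∀ v w, v ≠ w → t (Λ.ident v) * t (Λ.ident w) = 0
  mul : ∀ a b h, t a * t b = t (Λ.comp a b h)
  star_mul : ∀ a, star (t a) * t a = t (Λ.ident (Λ.s a))
  sum : ∀ v (n : Fin k → ℕ),
    t (Λ.ident v) = ∑ᶠ a : {a : Λ.Path // Λ.r a = v ∧ Λ.d a = n}, t a * star (t a)

theorem IsCuntzKrieger.norm_le {Λ : KGraph k} {B : Type*} [NonUnitalCStarAlgebra B]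
    {t : Λ.Path → B} (ht : Λ.IsCuntzKrieger t) (a : Λ.Path) : ‖t a‖ ≤ 1 := by
  have h1 : ‖star (t a) * t a‖ ≤ 1 := by
    rw [ht.star_mul]
    exact (ht.projection _).norm_le
  rw [CStarRing.norm_star_mul_self] at h1
  nlinarith [norm_nonneg (t a)]

/-- Bounded operators on `ℓ²(ℕ)`. -/
abbrev OpL2N : Type := lp (fun _ : ℕ => ℂ) 2 →L[ℂ] lp (fun _ : ℕ => ℂ) 2

/-- All Cuntz–Krieger `Λ`-families on `ℓ²(ℕ)`. -/
def CKFamily : Type := {T : Λ.Path → OpL2N // Λ.IsCuntzKrieger T}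

/-- The `ℓ^∞`-product, over all Cuntz–Krieger families on `ℓ²(ℕ)`, of `B(ℓ²(ℕ))`. -/
def CKProduct : Type := lp (fun _ : Λ.CKFamily => OpL2N) ∞

noncomputable instance : NonUnitalCStarAlgebra Λ.CKProduct :=
  inferInstanceAs (NonUnitalCStarAlgebra (lp (fun _ : Λ.CKFamily => OpL2N) ∞))

/-- The product of all Cuntz–Krieger families on `ℓ²(ℕ)`. -/
noncomputable def univFamily (a : Λ.Path) : Λ.CKProduct :=
  (⟨fun T => T.1 a, memℓp_infty ⟨1, by rintro _ ⟨T, rfl⟩; exact T.2.norm_le a⟩⟩ :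
    lp (fun _ : Λ.CKFamily => OpL2N) ∞)

/-- The Cuntz–Krieger algebra `C*(Λ)`: the C*-algebra generated by the universal family. Since
`Λ` is countable, every C*-algebra generated by a Cuntz–Krieger `Λ`-family is separable, hence
faithfully represented on `ℓ²(ℕ)`; so the family `univFamily` is the universal one. -/
noncomputable def cstar : NonUnitalStarSubalgebra ℂ Λ.CKProduct :=
  (NonUnitalStarAlgebra.adjoin ℂ (Set.range Λ.univFamily)).topologicalClosure

/-- The generator `t_a` of `C*(Λ)`. -/
noncomputable def gen (a : Λ.Path) : Λ.cstar :=
  ⟨Λ.univFamily a, subset_closure (NonUnitalStarAlgebra.subset_adjoin ℂ _ ⟨a, rfl⟩)⟩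

end KGraph

section Semibranching

variable {X : Type*} [MeasurableSpace X]

/-- The measure `μ ∘ τ : E ↦ μ(τ(E ∩ D))` for a map `τ : D → X` (meaningful when `τ` is injective
with measurable images). -/
noncomputable def compMeasure (μ : Measure X) {D : Set X} (τ : D → X) : Measure X :=
  (μ.comap τ).map Subtype.val

/-- The Radon–Nikodym derivative `Φ_τ = d(μ ∘ τ)/dμ`. -/
noncomputable def rnPrefix (μ : Measure X) {D : Set X} (τ : D → X) : X → ℝ≥0∞ :=
  (compMeasure μ τ).rnDeriv μ

/-- A semibranching function system `τ_i : D_i → X`. The fields `comp_measure` and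
`has_derivative` say that `μ ∘ τ_i` is a measure and that `Φ_{τ_i}` is its density. -/
structure IsSemibranching (μ : Measure X) {ι : Type*} (D : ι → Set X) (τ : ∀ i, D i → X) :
    Prop where
  measurable_domain : ∀ i, MeasurableSet (D i)
  measurable_map : ∀ i, Measurable (τ i)
  cover : μ (⋃ i, range (τ i))ᶜ = 0
  disjoint : ∀ i j, i ≠ j → μ (range (τ i) ∩ range (τ j)) = 0
  comp_measure : ∀ i (E : Set X), MeasurableSet E → E ⊆ D i →
    compMeasure μ (τ i) E = μ (τ i '' (Subtype.val ⁻¹' E))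
  has_derivative : ∀ i, compMeasure μ (τ i) = μ.withDensity (rnPrefix μ (τ i))
  derivative_pos : ∀ i, ∀ᵐ x ∂μ, x ∈ D i → 0 < rnPrefix μ (τ i) x

/-- `T` is a coding map for the family `τ_i : D_i → X`. -/
structure IsCodingMap {ι : Type*} (D : ι → Set X) (τ : ∀ i, D i → X) (T : X → X) : Prop where
  measurable : Measurable T
  left_inv : ∀ i (x : D i), T (τ i x) = x

/-- A `Λ`-semibranching function system on `(X, μ)`. -/
structure IsLambdaSemibranching {k : ℕ} (Λ : KGraph k) (μ : Measure X) (D : Λ.Path → Set X)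
    (τ : ∀ a, D a → X) (T : (Fin k → ℕ) → X → X) : Prop where
  semibranching : ∀ m, IsSemibranching μ (fun a : {a : Λ.Path // Λ.d a = m} => D a) (fun a => τ a)
  coding : ∀ m, IsCodingMap (fun a : {a : Λ.Path // Λ.d a = m} => D a) (fun a => τ a) (T m)
  vertex_id : ∀ v (x : D (Λ.ident v)), τ (Λ.ident v) x = x
  vertex_pos : ∀ v, 0 < μ (D (Λ.ident v))
  range_subset : ∀ a b, Λ.s a = Λ.r b → μ (range (τ b) \ D a) = 0
  comp_domain : ∀ a b (h : Λ.s a = Λ.r b), ∀ᵐ x ∂μ, x ∈ D b ↔ x ∈ D (Λ.comp a b h)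
  comp_map : ∀ a b (h : Λ.s a = Λ.r b), ∀ᵐ x ∂μ, ∀ (h1 : x ∈ D b) (h2 : τ b ⟨x, h1⟩ ∈ D a)
    (h3 : x ∈ D (Λ.comp a b h)), τ a ⟨τ b ⟨x, h1⟩, h2⟩ = τ (Λ.comp a b h) ⟨x, h3⟩
  coding_comp : ∀ m n, T m ∘ T n = T (m + n)

/-- `π` is the representation of `C*(Λ)` on `L²(X, μ)` attached to the system: `π(t_a) = S_a`,
`S_a ξ(x) = χ_{R_a}(x) Φ_{τ_a}(τ^{d(a)}(x))^{-1/2} ξ(τ^{d(a)}(x))`. -/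
def IsSemibranchingRep {k : ℕ} (Λ : KGraph k) (μ : Measure X) (D : Λ.Path → Set X)
    (τ : ∀ a, D a → X) (T : (Fin k → ℕ) → X → X)
    (π : Λ.cstar →⋆ₙₐ[ℂ] (Lp ℂ 2 μ →L[ℂ] Lp ℂ 2 μ)) : Prop :=
  ∀ (a : Λ.Path) (ξ : Lp ℂ 2 μ), (π (Λ.gen a) ξ : X → ℂ) =ᵐ[μ] (range (τ a)).indicator fun x =>
    (((rnPrefix μ (τ a) (T (Λ.d a) x)).toReal ^ (-(1 / 2) : ℝ) : ℝ) : ℂ) * ξ (T (Λ.d a) x)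

end Semibranching

/-- Unitary equivalence of two representations of `A` on Hilbert spaces. -/
def UnitarilyEquivalent {A H K : Type*} [NonUnitalSemiring A] [Star A] [Module ℂ A]
    [NormedAddCommGroup H] [InnerProductSpace ℂ H] [CompleteSpace H]
    [NormedAddCommGroup K] [InnerProductSpace ℂ K] [CompleteSpace K]
    (π : A →⋆ₙₐ[ℂ] (H →L[ℂ] H)) (π' : A →⋆ₙₐ[ℂ] (K →L[ℂ] K)) : Prop :=
  ∃ U : H ≃ₗᵢ[ℂ] K, ∀ (a : A) (ξ : H), U (π a ξ) = π' a (U ξ)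

namespace KGraph

variable {k : ℕ} (Λ : KGraph k)

/-- The standard prefixing and coding maps make `(Λ^∞, μ)` a `Λ`-semibranching function system. -/
def StandardSystem (μ : Measure Λ.InfPath) : Prop :=
  IsLambdaSemibranching Λ μ Λ.prefixDomain Λ.prefixMap Λ.shift

/-- `π` is the `Λ`-semibranching representation on `L²(Λ^∞, μ)` given by the standard prefixing
and coding maps. -/
def IsStandardRep (μ : Measure Λ.InfPath)
    (π : Λ.cstar →⋆ₙₐ[ℂ] (Lp ℂ 2 μ →L[ℂ] Lp ℂ 2 μ)) : Prop :=
  IsSemibranchingRep Λ μ Λ.prefixDomain Λ.prefixMap Λ.shift π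

end KGraph

section Example

/-- Exchange of the two blue edges, `f_1 = f 0` and `f_2 = f 1`. -/
def swapBlue (i : Fin 2) : Fin 2 := 1 - i

theorem swapBlue_swapBlue (i : Fin 2) : swapBlue (swapBlue i) = i := by
  revert i; decide

theorem swapBlue_iterate_cancel (n : ℕ) (i : Fin 2) : swapBlue^[n] (swapBlue^[n] i) = i :=
  (Function.Involutive.leftInverse swapBlue_swapBlue).iterate n i

/-- The 2-graph with one vertex, blue edges `f_1, f_2` (degree `e_1`), one red edge `e` (degree
`e_2`) and `f_1 e = e f_2`, `f_2 e = e f_1`. Every path has a unique expression `w e^n` with `w` a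
word in `f_1, f_2`; it is stored as `(w, n)`, and
`(w e^n)(w' e^m) = w (swap^n w') e^(n + m)`. -/
def flipGraph : KGraph 2 where
  Vertex := Unit
  Path := List (Fin 2) × ℕ
  countable_path := inferInstance
  r _ := ()
  s _ := ()
  ident _ := ([], 0)
  comp a b _ := (a.1 ++ b.1.map swapBlue^[a.2], a.2 + b.2)
  r_ident _ := rfl
  s_ident _ := rfl
  r_comp _ _ _ := rfl
  s_comp _ _ _ := rfl
  ident_comp a := by simp
  comp_ident a := by simp
  assoc a b c _ _ := by simp [Function.iterate_add, add_assoc]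
  d a := ![a.1.length, a.2]
  d_ident _ := by ext i; fin_cases i <;> rfl
  d_comp a b _ := by ext i; fin_cases i <;> simp
  factorization := by
    rintro ⟨w, n⟩ m l h
    have h0 : w.length = m 0 + l 0 := by simpa using congrFun h 0
    have h1 : n = m 1 + l 1 := by simpa using congrFun h 1
    have hc : swapBlue^[m 1] ∘ swapBlue^[m 1] = id := funext (swapBlue_iterate_cancel (m 1))
    refine ⟨((w.take (m 0), m 1), ((w.drop (m 0)).map swapBlue^[m 1], l 1)), ⟨⟨rfl, ?_⟩, ?_, ?_⟩,
      ?_⟩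
    · simp [List.map_map, hc, h1]
    · ext i; fin_cases i <;> simp [h0]
    · ext i; fin_cases i <;> simp [h0]
    · rintro ⟨⟨u, a⟩, ⟨u', b⟩⟩ ⟨⟨_, hw⟩, hd1, hd2⟩
      simp only [Prod.mk.injEq] at hw
      have ha : a = m 1 := by simpa using congrFun hd1 1
      have hb : b = l 1 := by simpa using congrFun hd2 1
      have hu : u.length = m 0 := by simpa using congrFun hd1 0
      subst ha hb
      rw [← hw.1, ← hu]
      simp [List.map_map, hc]

instance : Fintype flipGraph.Vertex := inferInstanceAs (Fintype Unit)

instance : DecidableEq flipGraph.Vertex := inferInstanceAs (DecidableEq Unit)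

/-- The unique vertex. -/
def flipV : flipGraph.Vertex := ()

/-- The red edge `e`. -/
def flipE : flipGraph.Path := ([], 1)

/-- The blue edges `f_1 = flipF 0` and `f_2 = flipF 1`. -/
def flipF (i : Fin 2) : flipGraph.Path := ([i], 0)

theorem flipF_comp_flipE (i : Fin 2) :
    flipGraph.comp (flipF i) flipE rfl = flipGraph.comp flipE (flipF (1 - i)) rfl := by
  fin_cases i <;> rfl

theorem blue_edges (a : flipGraph.Path) :
    flipGraph.d a = Pi.single 0 1 ↔ a = flipF 0 ∨ a = flipF 1 := by
  obtain ⟨w, n⟩ := a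
  constructor
  · intro h
    have h0 : w.length = 1 := by simpa [flipGraph] using congrFun h 0
    have h1 : n = 0 := by simpa [flipGraph] using congrFun h 1
    obtain ⟨i, rfl⟩ := List.length_eq_one_iff.1 h0
    subst h1
    fin_cases i
    · exact Or.inl rfl
    · exact Or.inr rfl
  · rintro (h | h) <;> rw [h] <;> ext i <;> fin_cases i <;> rfl

theorem red_edges (a : flipGraph.Path) : flipGraph.d a = Pi.single 1 1 ↔ a = flipE := by
  obtain ⟨w, n⟩ := a
  constructor
  · intro h
    have h0 : w.length = 0 := by simpa [flipGraph] using congrFun h 0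
    have h1 : n = 1 := by simpa [flipGraph] using congrFun h 1
    rw [List.length_eq_zero_iff] at h0
    subst h0 h1
    rfl
  · intro h
    rw [h]
    ext i
    fin_cases i <;> rfl

/-- The square path `e g_1 e g_2 ⋯ e g_n`, for `g_i` given as indices of blue edges. -/
def squarePath : List (Fin 2) → flipGraph.Path
  | [] => flipGraph.ident flipV
  | g :: gs => flipGraph.comp flipE (flipGraph.comp (flipF g) (squarePath gs) rfl) rfl

/-- The weight `1/2 + γ` of `f_1` and `1/2 - γ` of `f_2`. -/
noncomputable def weight (c : ℝ) (g : Fin 2) : ℝ := if g = 0 then 1 / 2 + c else 1 / 2 - c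

/-- `μ(Z(e g_1 ⋯ e g_n)) = ∏ α_i` for all `n` and all `g_1, …, g_n`; here `γ i` stands for
`γ_{i+1}`. -/
def ExtendsKakutani (γ : ℕ → ℝ) (μ : Measure flipGraph.InfPath) : Prop :=
  ∀ (n : ℕ) (g : Fin n → Fin 2),
    μ (flipGraph.cylinder (squarePath (List.ofFn g))) =
      ENNReal.ofReal (∏ i : Fin n, weight (γ i) (g i))

/-- `μ` is a Borel probability measure extending the weight function attached to `γ`. -/
structure IsKakutaniMeasure (γ : ℕ → ℝ) (μ : Measure flipGraph.InfPath) : Prop where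
  probability : IsProbabilityMeasure μ
  extends_weights : ExtendsKakutani γ μ

end Example

/-! Every finite path is `w e^n` with `w` a blue word, and an infinite path is determined by its
blue sequence, since the degree forces the red counts. This identifies the path space measurably
with `{0,1}^ℕ` (`pathOfSeq`, `measurable_blueSeq`), and `Z(w e^n)` depends on `w` only. Moving the
blue edges of `e g_1 e g_2 ⋯` to the left past the red ones flips `g_i` exactly `i` times, so the
prescribed weights amount to independent coordinates. Thus `μ` and `M` are product measures: they
exist as images of infinite products and are unique because cylinders form a π-system.

Every weight of `μ` lies between `(1 - 2|γ_i|)/2` and `(1 + 2|γ_i|)/2`. By summability the ratio of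
`μ` to `M` on cylinders is bounded and bounded away from zero, and `flip_absolutelyContinuous` turns
these bounds into equivalence of measures.

The rest uses equivalence with `M` only. Pushing `M` restricted to `Z(a)` forward by `σ^{d(a)}`
gives `2^{-|w|} M` (`perronFrobenius_map_shift`); quasi-invariance under prefixing passes to every
equivalent `ν`, which yields the semibranching system. On `L²(M)` the operators `2^{|w|/2} χ_{Z(a)}
(ξ ∘ σ^{d(a)})` form a Cuntz–Krieger family, hence come from a representation. If `ν = h M`,
multiplication by `√h` is a unitary from `L²(ν)` to `L²(M)` carrying the standard operators of `ν`
to those of `M` (`exists_unitary_isStandardRep_iff`). All standard representations are therefore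
conjugate to one and the same representation. -/

namespace KGraph

variable {k : ℕ} {Λ : KGraph k}

/-! ### Infinite paths, prefixing and shifts in a general `k`-graph. -/

theorem comp_congr {a b a' b' : Λ.Path} (h : Λ.s a = Λ.r b) (ha : a = a') (hb : b = b') :
    Λ.comp a b h = Λ.comp a' b' (ha ▸ hb ▸ h) := by
  subst ha hb; rfl

namespace InfPath

variable (x : Λ.InfPath)

theorem toFun_congr {p q p' q' : Fin k → ℕ} (h : p ≤ q) (hp : p = p') (hq : q = q') :
    x.toFun p q h = x.toFun p' q' (hp ▸ hq ▸ h) := by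
  subst hp hq; rfl

theorem s_eq_r {p q t : Fin k → ℕ} (hpq : p ≤ q) (hqt : q ≤ t) :
    Λ.s (x.toFun p q hpq) = Λ.r (x.toFun q t hqt) :=
  (x.s_toFun p q hpq).trans (x.r_toFun q t hqt).symm

/-- An infinite path is determined by its initial segments. -/
theorem ext_initial {x y : Λ.InfPath}
    (h : ∀ q, x.toFun 0 q zero_le = y.toFun 0 q zero_le) : x = y := by
  have hv : x.vertex = y.vertex := by
    ext q
    rw [← x.s_toFun 0 q zero_le, h, y.s_toFun]
  refine InfPath.ext hv ?_
  funext p q hpq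
  refine (comp_unique _ _ _ _ (x.s_eq_r zero_le hpq) (y.s_eq_r zero_le hpq) ?_ ?_).2
  · rw [x.map_comp, y.map_comp, h]
  · rw [h]

theorem shift_toFun (m p q : Fin k → ℕ) (h : p ≤ q) :
    (Λ.shift m x).toFun p q h = x.toFun (p + m) (q + m) (by gcongr) := rfl

theorem shift_comp (m n : Fin k → ℕ) : Λ.shift m ∘ Λ.shift n = Λ.shift (m + n) := by
  funext x
  refine ext_initial fun q => ?_
  simp only [Function.comp, shift_toFun]
  exact x.toFun_congr _ (by rw [add_assoc]) (by rw [add_assoc])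

theorem mem_cylinder {x : Λ.InfPath} {a : Λ.Path} :
    x ∈ Λ.cylinder a ↔ x.toFun 0 (Λ.d a) zero_le = a := Iff.rfl

end InfPath

section Prefix

variable (a : Λ.Path) (x : Λ.InfPath) (hx : Λ.s a = x.vertex 0)

theorem prefixed_toFun_zero (q : Fin k → ℕ) :
    (prefixed a x hx).toFun 0 q zero_le = prefixHead a x hx q := by
  have h0 : (0 : Fin k → ℕ) ≤ Λ.d (prefixHead a x hx q) := zero_le
  have e : Λ.s (Λ.ident (Λ.r (prefixHead a x hx q))) = Λ.r (prefixHead a x hx q) := Λ.s_ident _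
  refine (comp_unique _ _ _ _ (s_head (prefixHead a x hx q) 0 h0) e ?_ ?_).2
  · rw [head_comp_tail, Λ.ident_comp]
  · rw [d_head, Λ.d_ident]

/-- Both sides are initial segments of the same finite path `a x(0, d(a) + q)` and have equal
degree, so unique factorization identifies them. -/
theorem prefixHead_add (q : Fin k → ℕ) :
    prefixHead a x hx (Λ.d a + q) = prefixPath a x hx q := by
  have hq : q ≤ Λ.d a + q := le_add_self
  have hs : Λ.s (prefixPath a x hx q) = Λ.r (x.toFun q (Λ.d a + q) hq) := by
    rw [prefixPath, Λ.s_comp, x.s_eq_r]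
  refine (comp_unique _ _ _ _ (s_head _ _ (le_d_prefixPath a x hx (Λ.d a + q))) hs ?_ ?_).1
  · rw [head_comp_tail]
    simp only [prefixPath]
    rw [Λ.assoc _ _ _ _ (x.s_eq_r _ _)]
    exact comp_congr _ rfl (x.map_comp _ _ _ _ _).symm
  · rw [d_head, prefixPath, Λ.d_comp, x.d_toFun, tsub_zero]

theorem prefixed_mem_cylinder : prefixed a x hx ∈ Λ.cylinder a := by
  rw [InfPath.mem_cylinder, prefixed_toFun_zero]
  have h := prefixHead_add a x hx 0
  rw [add_zero] at h
  rw [h, prefixPath]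
  have e : Λ.s a = Λ.r (Λ.ident (Λ.s a)) := (Λ.r_ident _).symm
  conv_rhs => rw [← Λ.comp_ident a]
  exact comp_congr _ rfl (by rw [x.map_id, hx])

theorem shift_prefixed : Λ.shift (Λ.d a) (prefixed a x hx) = x := by
  refine InfPath.ext_initial fun q => ?_
  rw [InfPath.shift_toFun]
  set y := prefixed a x hx
  have h1 : y.toFun 0 (0 + Λ.d a) zero_le = a := by
    rw [y.toFun_congr zero_le rfl (zero_add _)]
    exact prefixed_mem_cylinder a x hx
  have h2 : y.toFun 0 (q + Λ.d a) zero_le = prefixPath a x hx q := by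
    rw [y.toFun_congr zero_le rfl (add_comm _ _), prefixed_toFun_zero, prefixHead_add]
  refine (comp_unique _ _ _ _ (y.s_eq_r zero_le (by gcongr; exact zero_le))
    (hx.trans (x.r_toFun 0 q zero_le).symm) ?_ ?_).2
  · rw [y.map_comp, h2]; rfl
  · rw [h1]

end Prefix

/-- An infinite path is determined by an initial segment and the corresponding shift. -/
theorem eq_of_mem_cylinder_of_shift_eq {a : Λ.Path} {x y : Λ.InfPath} (hx : x ∈ Λ.cylinder a)
    (hy : y ∈ Λ.cylinder a) (h : Λ.shift (Λ.d a) x = Λ.shift (Λ.d a) y) : x = y := by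
  refine InfPath.ext_initial fun q => ?_
  have key : ∀ z : Λ.InfPath, ∃ e e',
      z.toFun 0 (q + Λ.d a) zero_le =
        Λ.comp (z.toFun 0 (Λ.d a) zero_le) ((Λ.shift (Λ.d a) z).toFun 0 q zero_le) e ∧
      z.toFun 0 (q + Λ.d a) zero_le =
        Λ.comp (z.toFun 0 q zero_le) (z.toFun q (q + Λ.d a) le_self_add) e' := by
    intro z
    have hz : (Λ.shift (Λ.d a) z).toFun 0 q zero_le =
        z.toFun (Λ.d a) (q + Λ.d a) le_add_self :=
      z.toFun_congr _ (zero_add _) rfl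
    refine ⟨?_, z.s_eq_r _ _, ?_, (z.map_comp _ _ _ _ _).symm⟩
    · rw [hz, z.s_eq_r]
    · rw [comp_congr _ rfl hz]
      exact (z.map_comp _ _ _ _ _).symm
  obtain ⟨e1, e2, h1, h2⟩ := key x
  obtain ⟨e3, e4, h3, h4⟩ := key y
  refine (comp_unique _ _ _ _ e2 e4 ?_ ?_).1
  · rw [← h2, ← h4, h1, h3]
    exact comp_congr _ (hx.trans hy.symm) (by rw [h])
  · rw [x.d_toFun, y.d_toFun]

theorem vertex_shift_of_mem_cylinder {a : Λ.Path} {x : Λ.InfPath} (hx : x ∈ Λ.cylinder a) :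
    Λ.s a = (Λ.shift (Λ.d a) x).vertex 0 := by
  change _ = x.vertex (0 + Λ.d a)
  rw [zero_add, ← x.s_toFun 0 (Λ.d a) zero_le, InfPath.mem_cylinder.1 hx]

theorem prefixed_shift {a : Λ.Path} {x : Λ.InfPath} (hx : x ∈ Λ.cylinder a)
    (h : Λ.s a = (Λ.shift (Λ.d a) x).vertex 0) : prefixed a (Λ.shift (Λ.d a) x) h = x :=
  eq_of_mem_cylinder_of_shift_eq (prefixed_mem_cylinder _ _ _) hx (shift_prefixed _ _ _)

theorem cylinder_comp (a b : Λ.Path) (h : Λ.s a = Λ.r b) :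
    Λ.cylinder (Λ.comp a b h) = Λ.cylinder a ∩ Λ.shift (Λ.d a) ⁻¹' Λ.cylinder b := by
  ext x
  simp only [mem_inter_iff, mem_preimage, InfPath.mem_cylinder, InfPath.shift_toFun]
  have hd : Λ.d (Λ.comp a b h) = Λ.d b + Λ.d a := by rw [Λ.d_comp, add_comm]
  rw [x.toFun_congr zero_le rfl hd,
    x.toFun_congr (p := 0 + Λ.d a) (q' := Λ.d b + Λ.d a) _ (zero_add _) rfl,
    ← x.map_comp 0 (Λ.d a) (Λ.d b + Λ.d a) zero_le le_add_self]
  constructor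
  · intro e
    exact comp_unique _ _ _ _ _ _ e (by rw [x.d_toFun, tsub_zero])
  · rintro ⟨h1, h2⟩
    exact comp_congr _ h1 h2

end KGraph

/-! ### Representations of `C*(Λ)`: determined by generators, and built from Cuntz–Krieger families.
-/

namespace KGraph
variable {k : ℕ} (Λ : KGraph k)

theorem isClosed_cstar : IsClosed (Λ.cstar : Set Λ.CKProduct) :=
  NonUnitalStarSubalgebra.isClosed_topologicalClosure _

noncomputable instance : NonUnitalCStarAlgebra Λ.cstar :=
  NonUnitalStarSubalgebra.nonUnitalCStarAlgebra Λ.cstar (h_closed := Λ.isClosed_cstar)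

/-- The coordinate representation of `C*(Λ)` attached to a Cuntz–Krieger family on `ℓ²(ℕ)`. -/
noncomputable def coordRep (T : Λ.CKFamily) : Λ.cstar →⋆ₙₐ[ℂ] OpL2N where
  toFun a := (show lp (fun _ : Λ.CKFamily => OpL2N) ∞ from a.1) T
  map_smul' _ _ := rfl
  map_zero' := rfl
  map_add' _ _ := rfl
  map_mul' _ _ := rfl
  map_star' _ := rfl

variable {Λ}

open scoped CStarAlgebra in
/-- A representation of `C*(Λ)` is determined by the images of the generators. -/
theorem hom_ext_gen {B : Type*} [NonUnitalCStarAlgebra B]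
    {π π' : Λ.cstar →⋆ₙₐ[ℂ] B} (h : ∀ a, π (Λ.gen a) = π' (Λ.gen a)) : π = π' := by
  -- Star homomorphisms between C*-algebras are automatically continuous, so agreement on the dense
  -- star-algebra generated by the `t_a` suffices.
  have hc : Continuous π := map_continuous π
  have hc' : Continuous π' := map_continuous π'
  set A₀ := NonUnitalStarAlgebra.adjoin ℂ (Set.range Λ.univFamily) with hA₀
  have hle : (A₀ : Set Λ.CKProduct) ⊆ Λ.cstar := subset_closure
  have hd : DenseRange (inclusion hle) := denseRange_inclusion_iff hle |>.2 subset_rfl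
  have key : ∀ x (hx : x ∈ A₀), π ⟨x, hle hx⟩ = π' ⟨x, hle hx⟩ := by
    intro x hx
    induction hx using NonUnitalStarAlgebra.adjoin_induction with
    | mem x hx =>
      obtain ⟨a, rfl⟩ := hx
      exact h a
    | add x y hx hy ihx ihy =>
      have := congrArg₂ (· + ·) ihx ihy
      simp only [← map_add] at this
      exact this
    | zero => exact (map_zero π).trans (map_zero π').symm
    | mul x y hx hy ihx ihy =>
      have := congrArg₂ (· * ·) ihx ihy
      simp only [← map_mul] at this
      exact this
    | smul r x hx ihx =>
      have := congrArg (r • ·) ihx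
      simp only [← map_smul] at this
      exact this
    | star x hx ihx =>
      have := congrArg star ihx
      simp only [← map_star] at this
      exact this
  refine DFunLike.coe_injective (hd.equalizer hc hc' ?_)
  funext x
  exact key x.1 x.2

/-- The image of a Cuntz–Krieger family under a star isomorphism. -/
theorem IsCuntzKrieger.map {B C : Type*} [NonUnitalSemiring B] [Star B] [NonUnitalSemiring C]
    [Star C] {F : Type*} [EquivLike F B C] [RingEquivClass F B C] [StarHomClass F B C]
    {t : Λ.Path → B} (ht : Λ.IsCuntzKrieger t) (φ : F) :
    Λ.IsCuntzKrieger fun a => φ (t a) where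
  projection v := ⟨by
    rw [IsIdempotentElem, ← map_mul]; exact congrArg φ (ht.projection v).isIdempotentElem, by
    rw [IsSelfAdjoint, ← map_star]; exact congrArg φ (ht.projection v).isSelfAdjoint⟩
  orthogonal v w h := by rw [← map_mul, ht.orthogonal v w h, map_zero]
  mul a b h := by rw [← map_mul, ht.mul a b h]
  star_mul a := by rw [← map_star, ← map_mul, ht.star_mul]
  sum v n := by
    -- An additive equivalence commutes with `finsum` without any finiteness assumption on the
    -- support.
    have e := AddEquiv.map_finsum (φ : B ≃+ C) fun a : {a : Λ.Path // Λ.r a = v ∧ Λ.d a = n} =>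
      t a * star (t a)
    rw [ht.sum v n]
    refine e.trans (finsum_congr fun a => ?_)
    change φ (t a * star (t a)) = _
    rw [map_mul, map_star]

section Hilbert

variable {H : Type*} [NormedAddCommGroup H] [InnerProductSpace ℂ H] [CompleteSpace H]

/-- A separable infinite-dimensional Hilbert space is isomorphic to `ℓ²(ℕ)`. -/
theorem _root_.nonempty_linearIsometryEquiv_lp_nat [SecondCountableTopology H]
    (hH : ¬ FiniteDimensional ℂ H) :
    Nonempty (H ≃ₗᵢ[ℂ] lp (fun _ : ℕ => ℂ) 2) := by
  obtain ⟨w, b, hb⟩ := exists_hilbertBasis ℂ H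
  have hcount : Countable w := by
    -- Orthonormal vectors are `√2` apart, so the basis is a discrete subset of a second countable
    -- space and hence countable.
    have : Pairwise fun i j : w => 1 ≤ dist i j := by
      intro i j hij
      have h1 : ‖b i - b j‖ ^ 2 = 2 := by
        rw [@norm_sub_sq ℂ, b.orthonormal.norm_eq_one, b.orthonormal.norm_eq_one,
          b.orthonormal.inner_eq_zero hij]
        norm_num
      rw [Subtype.dist_eq, ← hb, dist_eq_norm]
      nlinarith [norm_nonneg (b i - b j)]
    have := DiscreteTopology.of_forall_le_dist one_pos this
    exact TopologicalSpace.separableSpace_iff_countable.1 inferInstance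
  have hinf : Infinite w := by
    by_contra hfin
    rw [not_infinite_iff_finite] at hfin
    apply hH
    have := Fintype.ofFinite w
    exact b.toOrthonormalBasis.toBasis.finiteDimensional_of_finite
  obtain ⟨e⟩ : Nonempty (ℕ ≃ w) := nonempty_equiv_of_countable
  refine ⟨(HilbertBasis.mk (b.orthonormal.comp e e.injective) ?_).repr⟩
  rw [e.surjective.range_comp, b.dense_span]

/-- The representation of `C*(Λ)` attached to a Cuntz–Krieger family on a separable
infinite-dimensional Hilbert space. -/
theorem IsCuntzKrieger.exists_rep [SecondCountableTopology H]
    (hH : ¬ FiniteDimensional ℂ H) {S : Λ.Path → H →L[ℂ] H} (hS : Λ.IsCuntzKrieger S) :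
    ∃ π : Λ.cstar →⋆ₙₐ[ℂ] (H →L[ℂ] H), ∀ a, π (Λ.gen a) = S a := by
  obtain ⟨V⟩ := nonempty_linearIsometryEquiv_lp_nat hH
  -- Once moved to `ℓ²(ℕ)`, the family is one of the coordinates of the product that contains
  -- `C*(Λ)`; evaluating at that coordinate is the representation.
  let T : Λ.CKFamily := ⟨fun a => V.conjStarAlgEquiv (S a), hS.map V.conjStarAlgEquiv⟩
  refine ⟨(V.symm.conjStarAlgEquiv : _ →⋆ₙₐ[ℂ] _).comp (Λ.coordRep T), fun a => ?_⟩
  change V.symm.conjStarAlgEquiv (V.conjStarAlgEquiv (S a)) = S a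
  ext ξ
  simp

end Hilbert

end KGraph

/-! ### The Borel structure of the path space. -/

namespace KGraph

variable {k : ℕ} {Λ : KGraph k}

theorem measurableSpace_infPath :
    Λ.instMeasurableSpaceInfPath =
      MeasurableSpace.generateFrom (range Λ.cylinder) := by
  have := Λ.countable_path
  have : SecondCountableTopology Λ.InfPath := ⟨⟨_, countable_range _, rfl⟩⟩
  exact borel_eq_generateFrom_of_subbasis rfl

theorem measurableSet_cylinder (a : Λ.Path) : MeasurableSet (Λ.cylinder a) := by
  rw [measurableSpace_infPath]
  exact MeasurableSpace.measurableSet_generateFrom (mem_range_self a)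

theorem measurable_of_cylinder {X : Type*} [MeasurableSpace X] {f : X → Λ.InfPath}
    (h : ∀ a, MeasurableSet (f ⁻¹' Λ.cylinder a)) : Measurable f := by
  rw [measurableSpace_infPath]
  refine measurable_generateFrom ?_
  rintro _ ⟨a, rfl⟩
  exact h a

/-- Sorting the paths by their initial segment of degree `m` exhibits the preimage as a countable
union of cylinders, whence the shifts are measurable. -/
theorem preimage_shift_cylinder (m : Fin k → ℕ) (b : Λ.Path) :
    Λ.shift m ⁻¹' Λ.cylinder b =
      ⋃ a : {a : Λ.Path // Λ.d a = m ∧ Λ.s a = Λ.r b}, Λ.cylinder (Λ.comp a b a.2.2) := by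
  ext x
  simp only [mem_preimage, mem_iUnion, cylinder_comp, mem_inter_iff]
  constructor
  · intro h
    have hd : Λ.d (x.toFun 0 m zero_le) = m := by rw [x.d_toFun, tsub_zero]
    have hs : Λ.s (x.toFun 0 m zero_le) = Λ.r b := by
      rw [x.s_toFun, ← InfPath.mem_cylinder.1 h, InfPath.shift_toFun, x.r_toFun, zero_add]
    refine ⟨⟨x.toFun 0 m zero_le, hd, hs⟩, ?_, by rwa [hd]⟩
    exact x.toFun_congr _ rfl hd
  · rintro ⟨⟨a, hd, hs⟩, -, h⟩
    rwa [← hd]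

theorem measurable_shift (m : Fin k → ℕ) : Measurable (Λ.shift m) := by
  have := Λ.countable_path
  refine measurable_of_cylinder fun b => ?_
  rw [preimage_shift_cylinder]
  exact MeasurableSet.iUnion fun a => measurableSet_cylinder _

end KGraph

/-! ### The flip graph: paths as words and the path space as `{0,1}^ℕ`. -/

open KGraph

/-- The blue word `w` of the path `w e^n`. -/
def blueWord (a : flipGraph.Path) : List (Fin 2) := Prod.fst (α := List (Fin 2)) (β := ℕ) a

/-- The exponent `n` of the path `w e^n`. -/
def redCount (a : flipGraph.Path) : ℕ := Prod.snd (α := List (Fin 2)) (β := ℕ) a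

/-- The path `w e^n`. -/
def flipPath (w : List (Fin 2)) (n : ℕ) : flipGraph.Path := (w, n)

@[simp]
theorem blueWord_flipPath (w : List (Fin 2)) (n : ℕ) : blueWord (flipPath w n) = w := rfl

@[simp]
theorem redCount_flipPath (w : List (Fin 2)) (n : ℕ) : redCount (flipPath w n) = n := rfl

theorem flip_path_ext {a b : flipGraph.Path} (h : blueWord a = blueWord b)
    (h' : redCount a = redCount b) : a = b := Prod.ext h h'

theorem flip_d (a : flipGraph.Path) : flipGraph.d a = ![(blueWord a).length, redCount a] := rfl

theorem length_blueWord (a : flipGraph.Path) : (blueWord a).length = flipGraph.d a 0 := rfl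

theorem redCount_eq (a : flipGraph.Path) : redCount a = flipGraph.d a 1 := rfl

theorem blueWord_comp (a b : flipGraph.Path) (h) :
    blueWord (flipGraph.comp a b h) = blueWord a ++ (blueWord b).map swapBlue^[redCount a] := rfl

theorem redCount_comp (a b : flipGraph.Path) (h) :
    redCount (flipGraph.comp a b h) = redCount a + redCount b := rfl

/-- The sequence of blue edges of an infinite path. -/
def blueSeq (x : flipGraph.InfPath) (i : ℕ) : Fin 2 :=
  (blueWord (x.toFun 0 ![i + 1, 0] zero_le)).getD i 0

theorem blueWord_toFun_zero (x : flipGraph.InfPath) (q : Fin 2 → ℕ) :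
    blueWord (x.toFun 0 q zero_le) = List.ofFn fun j : Fin (q 0) => blueSeq x j := by
  have hl : (blueWord (x.toFun 0 q zero_le)).length = q 0 := by
    rw [length_blueWord, x.d_toFun]; simp
  refine List.ext_getElem (by simp [hl]) fun i h1 h2 => ?_
  have hi : i < q 0 := hl ▸ h1
  have hle : ![i + 1, 0] ≤ q := by
    intro j; fin_cases j
    · exact hi
    · exact Nat.zero_le _
  have hl' : (blueWord (x.toFun 0 ![i + 1, 0] zero_le)).length = i + 1 := by
    rw [length_blueWord, x.d_toFun]; simp
  have e := x.map_comp 0 ![i + 1, 0] q zero_le hle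
  have e' := congrArg blueWord e
  rw [blueWord_comp] at e'
  simp only [List.getElem_ofFn, blueSeq]
  -- The word has length `i + 1`, so the default value in `blueSeq` is never used.
  rw [List.getD_eq_getElem _ _ (by omega)]
  simp only [← e']
  rw [List.getElem_append_left]

theorem redCount_toFun_zero (x : flipGraph.InfPath) (q : Fin 2 → ℕ) :
    redCount (x.toFun 0 q zero_le) = q 1 := by
  rw [redCount_eq, x.d_toFun, tsub_zero]

theorem blueSeq_injective : Function.Injective blueSeq := by
  intro x y h
  refine InfPath.ext_initial fun q => flip_path_ext ?_ ?_
  · rw [blueWord_toFun_zero, blueWord_toFun_zero, h]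
  · rw [redCount_toFun_zero, redCount_toFun_zero]

theorem mem_flip_cylinder {x : flipGraph.InfPath} {a : flipGraph.Path} :
    x ∈ flipGraph.cylinder a ↔
      (List.ofFn fun j : Fin (blueWord a).length => blueSeq x j) = blueWord a := by
  rw [InfPath.mem_cylinder]
  constructor
  · intro h
    conv_rhs => rw [← h, blueWord_toFun_zero]
    rfl
  · intro h
    refine flip_path_ext ?_ ?_
    · rw [blueWord_toFun_zero]; exact h
    · rw [redCount_toFun_zero]; rfl

theorem mem_flip_cylinder_iff_forall {x : flipGraph.InfPath} {a : flipGraph.Path} :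
    x ∈ flipGraph.cylinder a ↔
      ∀ i (h : i < (blueWord a).length), blueSeq x i = (blueWord a)[i] := by
  rw [mem_flip_cylinder]
  constructor
  · intro h i hi
    have e := congrArg (fun l : List (Fin 2) => l[i]?) h
    simp only [List.getElem?_ofFn, dif_pos hi, List.getElem?_eq_getElem hi] at e
    exact Option.some.inj e
  · intro h
    refine List.ext_getElem (by simp) fun i h1 h2 => ?_
    simpa using h i h2

/-- The infinite path with a given sequence of blue edges. -/
def pathOfSeq (w : ℕ → Fin 2) : flipGraph.InfPath where
  vertex _ := ()
  toFun p q _ :=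
    -- The segment from `p` to `q` follows `e^{p 1}`, and reading its blue edges past these red
    -- edges swaps each of them `p 1` times; the iterate of `swapBlue` undoes this.
    flipPath (List.ofFn fun j : Fin (q 0 - p 0) => swapBlue^[p 1] (w (p 0 + j))) (q 1 - p 1)
  r_toFun _ _ _ := rfl
  s_toFun _ _ _ := rfl
  map_id p := by
    refine flip_path_ext ?_ ?_
    · apply List.eq_nil_of_length_eq_zero
      rw [length_blueWord]
      change List.length (List.ofFn _) = 0
      simp
    · exact Nat.sub_self _
  map_comp p q t hpq hqt := by
    have h0 : p 0 ≤ q 0 := hpq 0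
    have h1 : p 1 ≤ q 1 := hpq 1
    have h0' : q 0 ≤ t 0 := hqt 0
    have h1' : q 1 ≤ t 1 := hqt 1
    refine flip_path_ext ?_ ?_
    · rw [blueWord_comp]
      refine List.ext_getElem (by simp; omega) fun i hi hi' => ?_
      simp only [blueWord_flipPath, redCount_flipPath, List.map_ofFn, List.getElem_append,
        List.length_ofFn, List.getElem_ofFn, Function.comp_apply]
      split_ifs with hlt
      · rfl
      · have e : q 1 = (q 1 - p 1) + p 1 := by omega
        have e2 : q 0 + (i - (q 0 - p 0)) = p 0 + i := by omega
        rw [e2, congrArg (fun m => swapBlue^[m] (w (p 0 + i))) e,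
          Function.iterate_add_apply, swapBlue_iterate_cancel]
    · rw [redCount_comp]
      simp only [redCount_flipPath]
      omega
  d_toFun p q h := by
    ext i; fin_cases i
    · simp [flip_d]
    · rfl

theorem blueSeq_pathOfSeq (w : ℕ → Fin 2) : blueSeq (pathOfSeq w) = w := by
  funext i
  rw [blueSeq, List.getD_eq_getElem _ _ (by simp [pathOfSeq])]
  simp only [pathOfSeq, blueWord_flipPath, List.getElem_ofFn]
  simp

theorem pathOfSeq_blueSeq (x : flipGraph.InfPath) : pathOfSeq (blueSeq x) = x :=
  blueSeq_injective (blueSeq_pathOfSeq _)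

theorem measurableSet_blueSeq_eq (i : ℕ) (c : Fin 2) : MeasurableSet {x | blueSeq x i = c} := by
  have : {x | blueSeq x i = c} = ⋃ a : {a : flipGraph.Path // (blueWord a)[i]? = some c},
      flipGraph.cylinder a := by
    ext x
    simp only [mem_ofPred_eq, mem_iUnion]
    constructor
    · rintro rfl
      refine ⟨⟨x.toFun 0 ![i + 1, 0] zero_le, ?_⟩, ?_⟩
      · rw [blueWord_toFun_zero, List.getElem?_ofFn]
        simp
      · exact x.toFun_congr _ rfl (by rw [x.d_toFun, tsub_zero])
    · rintro ⟨⟨a, ha⟩, hx⟩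
      obtain ⟨hi, ha⟩ := List.getElem?_eq_some_iff.1 ha
      rw [← ha]
      exact mem_flip_cylinder_iff_forall.1 hx i hi
  rw [this]
  have := flipGraph.countable_path
  exact MeasurableSet.iUnion fun a => measurableSet_cylinder _

theorem measurable_blueSeq : Measurable blueSeq := by
  refine measurable_pi_lambda _ fun i => measurable_to_countable' fun c => ?_
  exact measurableSet_blueSeq_eq i c

theorem preimage_pathOfSeq_cylinder (a : flipGraph.Path) :
    pathOfSeq ⁻¹' flipGraph.cylinder a =
      (Finset.range (blueWord a).length : Set ℕ).pi fun i => {(blueWord a).getD i 0} := by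
  ext w
  rw [mem_preimage, mem_flip_cylinder_iff_forall, blueSeq_pathOfSeq]
  simp only [mem_pi, Finset.coe_range, mem_Iio, mem_singleton_iff]
  refine forall_congr' fun i => forall_congr' fun hi => ?_
  rw [List.getD_eq_getElem _ _ hi]

theorem measurable_pathOfSeq : Measurable pathOfSeq := by
  refine measurable_of_cylinder fun a => ?_
  rw [preimage_pathOfSeq_cylinder]
  exact MeasurableSet.pi (Finset.countable_toSet _) fun i _ => MeasurableSet.singleton _

/-- Two cylinders that meet are nested: the one with the longer blue word is contained in the other.
-/
theorem isPiSystem_flip_cylinder : IsPiSystem (range flipGraph.cylinder) := by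
  have key : ∀ a b x, x ∈ flipGraph.cylinder a → x ∈ flipGraph.cylinder b →
      (blueWord a).length ≤ (blueWord b).length →
      flipGraph.cylinder b ⊆ flipGraph.cylinder a := by
    intro a b x ha hb hl y hy
    rw [mem_flip_cylinder_iff_forall] at *
    intro i hi
    rw [hy i (hi.trans_le hl), ← hb i (hi.trans_le hl), ha i hi]
  rintro _ ⟨a, rfl⟩ _ ⟨b, rfl⟩ ⟨x, ha, hb⟩
  rcases le_total (blueWord a).length (blueWord b).length with h | h
  · rw [inter_eq_right.2 (key a b x ha hb h)]; exact mem_range_self _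
  · rw [inter_eq_left.2 (key b a x hb ha h)]; exact mem_range_self _

theorem flip_cylinder_ident : flipGraph.cylinder (flipGraph.ident flipV) = univ := by
  ext x
  rw [mem_flip_cylinder_iff_forall]
  simp only [mem_univ, iff_true]
  intro i hi
  exact absurd hi (Nat.not_lt_zero i)

theorem flip_measure_ext {P Q : Measure flipGraph.InfPath} [IsFiniteMeasure P]
    (h : ∀ a, P (flipGraph.cylinder a) = Q (flipGraph.cylinder a)) : P = Q := by
  refine ext_of_generate_finite _ measurableSpace_infPath isPiSystem_flip_cylinder ?_ ?_
  · rintro _ ⟨a, rfl⟩; exact h a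
  · rw [← flip_cylinder_ident, h]

/-! ### Product measures on the path space and the measures attached to `γ`. -/

/-- The measure of a cylinder set for independent blue edges with weights `p i`. -/
def IsProductMeasure (p : ℕ → Fin 2 → ℝ) (μ : Measure flipGraph.InfPath) : Prop :=
  ∀ a, μ (flipGraph.cylinder a) =
    ENNReal.ofReal (∏ i : Fin (blueWord a).length, p i (blueWord a)[i])

theorem IsProductMeasure.isProbabilityMeasure {p : ℕ → Fin 2 → ℝ}
    {μ : Measure flipGraph.InfPath} (h : IsProductMeasure p μ) : IsProbabilityMeasure μ := by
  constructor
  have e := h (flipGraph.ident flipV)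
  rw [flip_cylinder_ident] at e
  rw [e]
  have : IsEmpty (Fin (blueWord (flipGraph.ident flipV)).length) := Fin.isEmpty
  rw [Finset.univ_eq_empty, Finset.prod_empty, ENNReal.ofReal_one]

theorem IsProductMeasure.eq {p : ℕ → Fin 2 → ℝ} {μ ν : Measure flipGraph.InfPath}
    (hμ : IsProductMeasure p μ) (hν : IsProductMeasure p ν) : μ = ν := by
  have := hμ.isProbabilityMeasure
  exact flip_measure_ext fun a => (hμ a).trans (hν a).symm

theorem exists_isProductMeasure {p : ℕ → Fin 2 → ℝ} (h0 : ∀ i c, 0 ≤ p i c)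
    (h1 : ∀ i, p i 0 + p i 1 = 1) : ∃ μ, IsProductMeasure p μ := by
  -- The measure sought is the image under `pathOfSeq` of the infinite product of these two-point
  -- distributions.
  let m : ℕ → Measure (Fin 2) := fun i => ∑ c, ENNReal.ofReal (p i c) • Measure.dirac c
  have hm : ∀ i c, m i {c} = ENNReal.ofReal (p i c) := by
    intro i c
    simp only [m, Measure.finsetSum_apply, Measure.smul_apply, smul_eq_mul,
      Measure.dirac_apply' _ (MeasurableSet.singleton c), indicator, mem_singleton_iff,
      Pi.one_apply, mul_ite, mul_one, mul_zero, Finset.sum_ite_eq', Finset.mem_univ, if_true]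
  have hprob : ∀ i, IsProbabilityMeasure (m i) := by
    intro i
    constructor
    simp only [m, Fin.sum_univ_two, Measure.add_apply, Measure.smul_apply, measure_univ,
      smul_eq_mul, mul_one]
    rw [← ENNReal.ofReal_add (h0 i 0) (h0 i 1), h1, ENNReal.ofReal_one]
  refine ⟨(Measure.infinitePi m).map pathOfSeq, fun a => ?_⟩
  rw [Measure.map_apply measurable_pathOfSeq (measurableSet_cylinder a),
    preimage_pathOfSeq_cylinder, Measure.infinitePi_pi _ fun i _ => MeasurableSet.singleton _,
    ENNReal.ofReal_prod_of_nonneg fun i _ => h0 _ _, Finset.prod_range]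
  refine Finset.prod_congr rfl fun i _ => ?_
  rw [hm, List.getD_eq_getElem _ _ i.2]
  rfl

/-- The weights of the blue edges for the measure attached to `γ`. -/
noncomputable def kakutaniWeight (γ : ℕ → ℝ) (i : ℕ) (c : Fin 2) : ℝ :=
  weight (γ i) (swapBlue^[i + 1] c)

/-- The edge at index `i`, counted from zero, stands to the right of `i + 1` red edges, and passing
each of them swaps it once. -/
theorem blueWord_squarePath (l : List (Fin 2)) :
    blueWord (squarePath l) = l.mapIdx fun i c => swapBlue^[i + 1] c := by
  induction l with
  | nil => rfl
  | cons g gs ih =>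
    have : blueWord (squarePath (g :: gs)) =
        swapBlue g :: (blueWord (squarePath gs)).map swapBlue := by
      change List.map swapBlue (g :: List.map id (blueWord (squarePath gs))) = _
      rw [List.map_id, List.map_cons]
    rw [this, ih, List.mapIdx_cons]
    refine congrArg₂ _ rfl ?_
    refine List.ext_getElem (by simp) fun i _ _ => ?_
    simp only [List.getElem_map, List.getElem_mapIdx]
    exact (Function.iterate_succ_apply' swapBlue (i + 1) _).symm

theorem flip_cylinder_congr {a b : flipGraph.Path} (h : blueWord a = blueWord b) :
    flipGraph.cylinder a = flipGraph.cylinder b := by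
  ext x
  rw [mem_flip_cylinder, mem_flip_cylinder, h]

/-- Since the swaps are invertible, every blue word is the word of a unique square path, and a
cylinder depends only on its blue word. Prescribing the square cylinders therefore prescribes all
cylinders. -/
theorem extendsKakutani_iff (γ : ℕ → ℝ) (μ : Measure flipGraph.InfPath) :
    ExtendsKakutani γ μ ↔ IsProductMeasure (kakutaniWeight γ) μ := by
  have key : ∀ l' l : List (Fin 2), l' = blueWord (squarePath l) →
      ∏ i : Fin l'.length, kakutaniWeight γ i l'[i] = ∏ i : Fin l.length, weight (γ i) l[i] := by
    intro l' l h
    rw [blueWord_squarePath] at h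
    subst h
    refine Fintype.prod_equiv (finCongr List.length_mapIdx) _ _ fun i => ?_
    simp only [kakutaniWeight, Fin.getElem_fin, List.getElem_mapIdx, swapBlue_iterate_cancel,
      finCongr_apply_coe]
  constructor
  · intro h a
    let l := (blueWord a).mapIdx fun i c => swapBlue^[i + 1] c
    have hl : blueWord a = blueWord (squarePath l) := by
      rw [blueWord_squarePath]
      refine List.ext_getElem (by simp [l]) fun i _ _ => ?_
      simp only [l, List.getElem_mapIdx, swapBlue_iterate_cancel]
    have := h l.length l.get
    rw [List.ofFn_get] at this
    rw [flip_cylinder_congr hl, this, key _ l hl]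
    rfl
  · intro h n g
    rw [h, key _ _ rfl]
    congr 1
    refine Fintype.prod_equiv (finCongr List.length_ofFn) _ _ fun i => ?_
    simp only [Fin.getElem_fin, List.getElem_ofFn]
    rfl

theorem weight_swapBlue_add (c : ℝ) (i : ℕ) :
    weight c (swapBlue^[i] 0) + weight c (swapBlue^[i] 1) = 1 := by
  have h : ∀ i : ℕ, (swapBlue^[i] 0 = 0 ∧ swapBlue^[i] 1 = 1) ∨
      (swapBlue^[i] 0 = 1 ∧ swapBlue^[i] 1 = 0) := by
    intro i
    induction i with
    | zero => exact Or.inl ⟨rfl, rfl⟩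
    | succ n ih =>
      rw [Function.iterate_succ_apply', Function.iterate_succ_apply']
      rcases ih with ⟨h, h'⟩ | ⟨h, h'⟩ <;> rw [h, h']
      · exact Or.inr ⟨rfl, rfl⟩
      · exact Or.inl ⟨rfl, rfl⟩
  rcases h i with ⟨h, h'⟩ | ⟨h, h'⟩ <;> rw [h, h'] <;> simp [weight] <;> ring

theorem abs_weight_sub_half (c : ℝ) (g : Fin 2) : |weight c g - 1 / 2| = |c| := by
  unfold weight
  split_ifs <;> simp

theorem isKakutaniMeasure_iff (γ : ℕ → ℝ) (μ : Measure flipGraph.InfPath) :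
    IsKakutaniMeasure γ μ ↔ IsProductMeasure (kakutaniWeight γ) μ :=
  ⟨fun h => (extendsKakutani_iff γ μ).1 h.extends_weights,
    fun h => ⟨h.isProbabilityMeasure, (extendsKakutani_iff γ μ).2 h⟩⟩

theorem existsUnique_isKakutaniMeasure {γ : ℕ → ℝ} (hγ : ∀ i, |γ i| < 1 / 2) :
    ∃! μ, IsKakutaniMeasure γ μ := by
  have h0 : ∀ i c, 0 ≤ kakutaniWeight γ i c := by
    intro i c
    have h := hγ i
    rw [← abs_weight_sub_half (γ i) (swapBlue^[i + 1] c), abs_lt] at h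
    unfold kakutaniWeight
    linarith
  simp only [isKakutaniMeasure_iff]
  obtain ⟨μ, hμ⟩ := exists_isProductMeasure h0 fun i => weight_swapBlue_add _ _
  exact ⟨μ, hμ, fun ν hν => hν.eq hμ⟩

/-! ### Perron–Frobenius data of the flip graph: `ρ = (2, 1)`, `κ = 1`, and `M` has equal weights.
-/

theorem spectralRadius_unit_matrix (c : ℂ) :
    spectralRadius ℂ (Matrix.of fun _ _ : Unit => c) = ‖c‖ₑ := by
  have : (Matrix.of fun _ _ : Unit => c) = algebraMap ℂ (Matrix Unit Unit ℂ) c := by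
    ext i j
    simp [Matrix.algebraMap_matrix_apply]
  rw [this, spectralRadius, spectrum.scalar_eq]
  simp [enorm]

theorem flip_edgeCount (i : Fin 2) (v w : flipGraph.Vertex) :
    flipGraph.edgeCount i v w = if i = 0 then 2 else 1 := by
  unfold edgeCount
  have h : ∀ a : flipGraph.Path, (flipGraph.d a = Pi.single i 1 ∧ flipGraph.r a = v ∧
      flipGraph.s a = w) ↔ flipGraph.d a = Pi.single i 1 :=
    fun a => ⟨fun h => h.1, fun h => ⟨h, rfl, rfl⟩⟩
  simp only [h]
  fin_cases i
  · simp only [Fin.zero_eta, blue_edges, if_true]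
    have hne : flipF 0 ≠ flipF 1 := by
      intro h
      have := congrArg blueWord h
      simp [blueWord, flipF] at this
    exact Set.ncard_pair hne
  · simp only [Fin.mk_one, red_edges]
    simp

theorem flip_rho (i : Fin 2) : flipGraph.rho i = if i = 0 then 2 else 1 := by
  unfold rho
  simp only [flip_edgeCount]
  have := spectralRadius_unit_matrix (((if i = 0 then 2 else 1 : ℕ) : ℂ))
  refine (congrArg ENNReal.toReal this).trans ?_
  split_ifs <;> simp

theorem flip_isPerronFrobeniusVector_iff (κ : flipGraph.Vertex → ℝ) :
    flipGraph.IsPerronFrobeniusVector κ ↔ κ = fun _ => 1 := by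
  constructor
  · intro h
    funext v
    have := h.sum_eq_one
    exact (Fintype.sum_unique (ι := Unit) κ).symm.trans this
  · rintro rfl
    refine ⟨fun _ => one_pos, Fintype.sum_unique (ι := Unit) _, fun i => ?_⟩
    funext v
    simp only [flip_edgeCount, flip_rho, Matrix.mulVec, dotProduct, Matrix.of_apply]
    refine (Fintype.sum_unique (ι := Unit) _).trans ?_
    simp

theorem isPerronFrobeniusMeasure_iff (M : Measure flipGraph.InfPath) :
    flipGraph.IsPerronFrobeniusMeasure M ↔ IsProductMeasure (fun _ _ => 1 / 2) M := by
  unfold IsPerronFrobeniusMeasure IsProductMeasure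
  simp only [flip_isPerronFrobeniusVector_iff, exists_eq_left]
  refine forall_congr' fun a => ?_
  simp [flip_rho, flip_d]

theorem existsUnique_isPerronFrobeniusMeasure :
    ∃! M, flipGraph.IsPerronFrobeniusMeasure M := by
  simp only [isPerronFrobeniusMeasure_iff]
  obtain ⟨μ, hμ⟩ := exists_isProductMeasure (p := fun _ _ => 1 / 2) (fun _ _ => by positivity)
    fun _ => by norm_num
  exact ⟨μ, hμ, fun ν hν => hν.eq hμ⟩

/-! ### Mutual absolute continuity of `μ` and `M`. -/

theorem exists_prod_one_add_le {t : ℕ → ℝ} (h0 : ∀ i, 0 ≤ t i) (hs : Summable t) :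
    ∃ C : ℝ, 0 < C ∧ ∀ n, ∏ i ∈ Finset.range n, (1 + t i) ≤ C := by
  refine ⟨Real.exp (∑' i, t i), Real.exp_pos _, fun n => ?_⟩
  calc ∏ i ∈ Finset.range n, (1 + t i) ≤ ∏ i ∈ Finset.range n, Real.exp (t i) := by
        refine Finset.prod_le_prod (fun i _ => by linarith [h0 i]) fun i _ => ?_
        linarith [Real.add_one_le_exp (t i)]
    _ = Real.exp (∑ i ∈ Finset.range n, t i) := (Real.exp_sum _ _).symm
    _ ≤ _ := Real.exp_le_exp.2 (hs.sum_le_tsum _ fun i _ => h0 i)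

/-- Inverting, `1 / (1 - t) = 1 + t / (1 - t)`, and `t / (1 - t) ≤ 2 t` as soon as `t < 1/2`, which
holds eventually; this reduces to the upper bound for products `∏ (1 + t_i)`. -/
theorem exists_le_prod_one_sub {t : ℕ → ℝ} (h0 : ∀ i, 0 ≤ t i) (h1 : ∀ i, t i < 1)
    (hs : Summable t) : ∃ c : ℝ, 0 < c ∧ ∀ n, c ≤ ∏ i ∈ Finset.range n, (1 - t i) := by
  have hs' : Summable fun i => t i / (1 - t i) := by
    refine Summable.of_norm_bounded_eventually_nat (hs.mul_left 2) ?_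
    filter_upwards [hs.tendsto_atTop_zero.eventually_lt_const (show (0 : ℝ) < 1 / 2 by norm_num)]
      with i hi
    have h2 : 0 < 1 - t i := by linarith
    rw [Real.norm_of_nonneg (div_nonneg (h0 i) h2.le), div_le_iff₀ h2]
    nlinarith [h0 i]
  obtain ⟨C, hC, h⟩ := exists_prod_one_add_le
    (fun i => div_nonneg (h0 i) (sub_nonneg.2 (h1 i).le)) hs'
  refine ⟨C⁻¹, inv_pos.2 hC, fun n => ?_⟩
  have hpos : 0 < ∏ i ∈ Finset.range n, (1 - t i) :=
    Finset.prod_pos fun i _ => sub_pos.2 (h1 i)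
  refine inv_le_of_inv_le₀ hpos ?_
  rw [← Finset.prod_inv_distrib]
  refine le_trans (le_of_eq (Finset.prod_congr rfl fun i _ => ?_)) (h n)
  have h2 : 1 - t i ≠ 0 := (sub_pos.2 (h1 i)).ne'
  field_simp
  ring

/-- Finite measures whose ratio is bounded on cylinder sets are absolutely continuous. -/
theorem flip_absolutelyContinuous {P Q : Measure flipGraph.InfPath} [IsFiniteMeasure P]
    [IsFiniteMeasure Q] (C : ℝ≥0∞) (hC : C ≠ ∞)
    (h : ∀ a, P (flipGraph.cylinder a) ≤ C * Q (flipGraph.cylinder a)) : P ≪ Q := by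
  -- The comparison takes place on `{0,1}^ℕ`, a metrizable space, where finite Borel measures are
  -- outer regular.
  set P' := P.map blueSeq
  set Q' := Q.map blueSeq
  have := Measure.isFiniteMeasure_map P blueSeq
  have := Measure.isFiniteMeasure_map Q blueSeq
  let Z : ∀ n : ℕ, (Fin n → Fin 2) → Set (ℕ → Fin 2) := fun n v => {w | ∀ i : Fin n, w i = v i}
  have hZc : ∀ n v, blueSeq ⁻¹' Z n v = flipGraph.cylinder (flipPath (List.ofFn v) 0) := by
    intro n v
    ext x
    rw [mem_flip_cylinder_iff_forall]
    simp only [Z, mem_preimage, mem_ofPred_eq, blueWord_flipPath, List.length_ofFn,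
      List.getElem_ofFn]
    exact ⟨fun h i hi => h ⟨i, hi⟩, fun h i => h i i.2⟩
  have hZo : ∀ n v, IsOpen (Z n v) := by
    intro n v
    have : Z n v = ⋂ i : Fin n, (fun w : ℕ → Fin 2 => w i) ⁻¹' {v i} := by
      ext w; simp [Z]
    rw [this]
    exact isOpen_iInter_of_finite fun i => (isOpen_discrete _).preimage (continuous_apply _)
  have hZ : ∀ n v, P' (Z n v) ≤ C * Q' (Z n v) := by
    intro n v
    rw [Measure.map_apply measurable_blueSeq (hZo n v).measurableSet,
      Measure.map_apply measurable_blueSeq (hZo n v).measurableSet, hZc]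
    exact h _
  have hdisj : ∀ n, Pairwise (Function.onFun Disjoint (Z n)) := by
    intro n v v' hne
    refine Set.disjoint_left.2 fun w hw hw' => hne ?_
    funext i
    rw [← hw i, hw' i]
  have hopen : ∀ U : Set (ℕ → Fin 2), IsOpen U → P' U ≤ C * Q' U := by
    intro U hU
    let A : ∀ n : ℕ, Set (Fin n → Fin 2) := fun n => {v | Z n v ⊆ U}
    -- An open set is the increasing union over `n` of the level-`n` cylinders it contains. These
    -- are disjoint at each level, so the bound on cylinders adds up and passes to the limit.
    have hUn : U = ⋃ n, ⋃ v ∈ A n, Z n v := by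
      refine Subset.antisymm (fun w hw => ?_) ?_
      · obtain ⟨I, u, hu, hsub⟩ := isOpen_pi_iff.1 hU w hw
        obtain ⟨N, hN⟩ := I.exists_nat_subset_range
        simp only [mem_iUnion]
        refine ⟨N, fun i => w i, fun w' hw' => hsub fun i hi => ?_, fun i => rfl⟩
        have := hw' ⟨i, Finset.mem_range.1 (hN hi)⟩
        simp only at this
        rw [this]
        exact (hu i hi).2
      · simp only [iUnion_subset_iff]
        exact fun n v hv => hv
    have hmono : Monotone fun n => ⋃ v ∈ A n, Z n v := by
      intro n m hnm w hw
      simp only [mem_iUnion] at hw ⊢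
      obtain ⟨v, hv, hwv⟩ := hw
      refine ⟨fun i => w i, fun w' hw' => hv fun i => ?_, fun i => rfl⟩
      rw [← hwv i]
      exact hw' ⟨i, i.2.trans_le hnm⟩
    rw [hUn, hmono.measure_iUnion]
    refine iSup_le fun n => ?_
    have e : ∀ R : Measure (ℕ → Fin 2), R (⋃ v ∈ A n, Z n v) = ∑' v : A n, R (Z n v) :=
      fun R => measure_biUnion (to_countable _) (fun v _ v' _ hne => hdisj n hne)
        fun v _ => (hZo n v).measurableSet
    calc P' (⋃ v ∈ A n, Z n v) ≤ C * Q' (⋃ v ∈ A n, Z n v) := by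
          rw [e, e, ← ENNReal.tsum_mul_left]
          exact ENNReal.tsum_le_tsum fun v => hZ n v
      _ ≤ _ := by gcongr; exact subset_iUnion (fun n => ⋃ v ∈ A n, Z n v) n
  have key : P' ≪ Q' := by
    refine Measure.AbsolutelyContinuous.mk fun s hs h0 => ?_
    refine le_antisymm (ENNReal.le_of_forall_pos_le_add fun ε hε _ => ?_) zero_le
    -- The divisor is `C + 1` rather than `C` because `C` may be zero.
    have hC1 : C + 1 ≠ 0 := by simp
    have hC2 : C + 1 ≠ ∞ := by simp [hC]
    obtain ⟨U, hsU, hU, hQU⟩ := s.exists_isOpen_le_add Q'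
      (ε := ε / (C + 1)) (ENNReal.div_pos (by simpa using hε.ne') hC2).ne'
    rw [h0, zero_add] at hQU
    calc P' s ≤ P' U := measure_mono hsU
      _ ≤ C * Q' U := hopen U hU
      _ ≤ (C + 1) * (ε / (C + 1)) := by gcongr; exact le_self_add
      _ = 0 + ε := by rw [ENNReal.mul_div_cancel hC1 hC2, zero_add]
  have hmap : ∀ R : Measure flipGraph.InfPath, (R.map blueSeq).map pathOfSeq = R := by
    intro R
    rw [Measure.map_map measurable_pathOfSeq measurable_blueSeq]
    convert! Measure.map_id
    exact funext pathOfSeq_blueSeq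
  rw [← hmap P, ← hmap Q]
  exact key.map measurable_pathOfSeq

/-- Each factor of `μ` deviates from `1/2` by exactly `|γ_i|`, so the cylinder ratio of `μ` to `M`
lies between `∏ (1 - 2|γ_i|)` and `∏ (1 + 2|γ_i|)`. The strict bound `|γ_i| < 1/2` keeps the lower
product positive. -/
theorem kakutani_equivalent {γ : ℕ → ℝ} (hγ : ∀ i, |γ i| < 1 / 2)
    (hsum : Summable fun i => |γ i|) {μ M : Measure flipGraph.InfPath}
    (hμ : IsKakutaniMeasure γ μ) (hM : flipGraph.IsPerronFrobeniusMeasure M) :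
    μ ≪ M ∧ M ≪ μ := by
  rw [isKakutaniMeasure_iff] at hμ
  rw [isPerronFrobeniusMeasure_iff] at hM
  have := hμ.isProbabilityMeasure
  have := hM.isProbabilityMeasure
  have h0 : ∀ i, 0 ≤ 2 * |γ i| := fun i => by positivity
  have h1 : ∀ i, 2 * |γ i| < 1 := fun i => by linarith [hγ i]
  have hw : ∀ i c, |kakutaniWeight γ i c - 1 / 2| = |γ i| := fun i c => abs_weight_sub_half _ _
  obtain ⟨C, hC, hC'⟩ := exists_prod_one_add_le h0 (hsum.mul_left 2)
  obtain ⟨c, hc, hc'⟩ := exists_le_prod_one_sub h0 h1 (hsum.mul_left 2)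
  constructor
  · refine flip_absolutelyContinuous (ENNReal.ofReal C) ENNReal.ofReal_ne_top fun a => ?_
    rw [hμ, hM, ← ENNReal.ofReal_mul hC.le]
    refine ENNReal.ofReal_le_ofReal ?_
    have h := hC' (blueWord a).length
    rw [Finset.prod_range] at h
    refine le_trans ?_ (mul_le_mul_of_nonneg_right h (Finset.prod_nonneg fun _ _ => by norm_num))
    rw [← Finset.prod_mul_distrib]
    refine Finset.prod_le_prod (fun i _ => ?_) fun i _ => ?_ <;>
    · have := hw i (blueWord a)[i]
      have h' := h1 i
      have := abs_le.1 this.le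
      linarith
  · refine flip_absolutelyContinuous (ENNReal.ofReal c⁻¹) ENNReal.ofReal_ne_top fun a => ?_
    rw [hμ, hM, ← ENNReal.ofReal_mul (inv_pos.2 hc).le]
    refine ENNReal.ofReal_le_ofReal ?_
    rw [← div_eq_inv_mul, le_div_iff₀' hc]
    have h := hc' (blueWord a).length
    rw [Finset.prod_range] at h
    refine le_trans (mul_le_mul_of_nonneg_right h (Finset.prod_nonneg fun _ _ => by norm_num)) ?_
    rw [← Finset.prod_mul_distrib]
    refine Finset.prod_le_prod (fun i _ => ?_) fun i _ => ?_ <;>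
    · have := hw i (blueWord a)[i]
      have h' := h1 i
      have := abs_le.1 this.le
      linarith

/-! ### Prefixing maps as measurable embeddings inverted by the shifts. -/

namespace KGraph

variable {k : ℕ} {Λ : KGraph k}

theorem shift_zero (x : Λ.InfPath) : Λ.shift 0 x = x :=
  InfPath.ext_initial fun _ => x.toFun_congr _ (add_zero _) (add_zero _)

theorem shift_d_comp (a b : Λ.Path) (h : Λ.s a = Λ.r b) (x : Λ.InfPath) :
    Λ.shift (Λ.d (Λ.comp a b h)) x = Λ.shift (Λ.d b) (Λ.shift (Λ.d a) x) := by
  rw [Λ.d_comp, add_comm, ← InfPath.shift_comp]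
  rfl

theorem mem_prefixDomain {a : Λ.Path} {x : Λ.InfPath} :
    x ∈ Λ.prefixDomain a ↔ Λ.s a = x.vertex 0 := by
  refine ⟨Λ.source_eq_of_mem_prefixDomain, fun h => ?_⟩
  change x.toFun 0 (Λ.d (Λ.ident (Λ.s a))) zero_le = _
  rw [x.toFun_congr zero_le rfl (Λ.d_ident _), x.map_id, h]

theorem prefixMap_mem_cylinder (a : Λ.Path) (x : Λ.prefixDomain a) :
    Λ.prefixMap a x ∈ Λ.cylinder a := prefixed_mem_cylinder _ _ _

theorem shift_prefixMap (a : Λ.Path) (x : Λ.prefixDomain a) :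
    Λ.shift (Λ.d a) (Λ.prefixMap a x) = x := shift_prefixed _ _ _

theorem shift_mem_prefixDomain {a : Λ.Path} {x : Λ.InfPath} (hx : x ∈ Λ.cylinder a) :
    Λ.shift (Λ.d a) x ∈ Λ.prefixDomain a :=
  mem_prefixDomain.2 (vertex_shift_of_mem_cylinder hx)

theorem prefixMap_shift {a : Λ.Path} {x : Λ.InfPath} (hx : x ∈ Λ.cylinder a) :
    Λ.prefixMap a ⟨Λ.shift (Λ.d a) x, shift_mem_prefixDomain hx⟩ = x :=
  prefixed_shift hx _

theorem prefixMap_injective (a : Λ.Path) : Function.Injective (Λ.prefixMap a) := by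
  intro x y h
  have := congrArg (Λ.shift (Λ.d a)) h
  rw [shift_prefixMap, shift_prefixMap] at this
  exact Subtype.ext this

theorem image_prefixMap (a : Λ.Path) (t : Set Λ.InfPath) :
    Λ.prefixMap a '' (Subtype.val ⁻¹' t) = Λ.cylinder a ∩ Λ.shift (Λ.d a) ⁻¹' t := by
  ext y
  constructor
  · rintro ⟨x, hx, rfl⟩
    refine ⟨prefixMap_mem_cylinder a x, ?_⟩
    rw [mem_preimage, shift_prefixMap]
    exact hx
  · rintro ⟨hy, ht⟩
    exact ⟨⟨_, shift_mem_prefixDomain hy⟩, ht, prefixMap_shift hy⟩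

theorem range_prefixMap (a : Λ.Path) : range (Λ.prefixMap a) = Λ.cylinder a := by
  rw [← image_univ, ← preimage_univ (f := Subtype.val), image_prefixMap, preimage_univ, inter_univ]

theorem measurable_prefixMap (a : Λ.Path) : Measurable (Λ.prefixMap a) := by
  have := Λ.countable_path
  refine measurable_of_cylinder fun b => ?_
  -- The segment `(a x)(0, d(b))` depends only on `x(0, d(b))`, so the preimage is a union of
  -- cylinders, countable because there are countably many paths.
  have key : Λ.prefixMap a ⁻¹' Λ.cylinder b =
      ⋃ c : {c : Λ.Path // ∀ y : Λ.prefixDomain a, y.1 ∈ Λ.cylinder c →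
        Λ.prefixMap a y ∈ Λ.cylinder b}, Subtype.val ⁻¹' Λ.cylinder c.1 := by
    ext x
    simp only [mem_iUnion]
    constructor
    · intro hx
      have hd : Λ.d (x.1.toFun 0 (Λ.d b) zero_le) = Λ.d b := by rw [x.1.d_toFun, tsub_zero]
      refine ⟨⟨x.1.toFun 0 (Λ.d b) zero_le, fun y hy => ?_⟩, x.1.toFun_congr _ rfl hd⟩
      have hy' : y.1.toFun 0 (Λ.d b) zero_le = x.1.toFun 0 (Λ.d b) zero_le := by
        rw [← InfPath.mem_cylinder.1 hy]
        exact y.1.toFun_congr _ rfl hd.symm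
      have hp : prefixPath a y.1 (Λ.source_eq_of_mem_prefixDomain y.2) (Λ.d b) =
          prefixPath a x.1 (Λ.source_eq_of_mem_prefixDomain x.2) (Λ.d b) := comp_congr _ rfl hy'
      have hh : prefixHead a y.1 (Λ.source_eq_of_mem_prefixDomain y.2) (Λ.d b) =
          prefixHead a x.1 (Λ.source_eq_of_mem_prefixDomain x.2) (Λ.d b) := by
        simp only [prefixHead, hp]
      have hx' := InfPath.mem_cylinder.1 hx
      rw [InfPath.mem_cylinder]
      simp only [prefixMap, prefixed_toFun_zero] at hx' ⊢
      rw [hh, hx']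
    · rintro ⟨⟨c, hc⟩, hx⟩
      exact hc x hx
  rw [key]
  exact MeasurableSet.iUnion fun c => measurable_subtype_coe (measurableSet_cylinder _)

theorem measurableEmbedding_prefixMap (a : Λ.Path) : MeasurableEmbedding (Λ.prefixMap a) where
  injective := prefixMap_injective a
  measurable := measurable_prefixMap a
  measurableSet_image' := by
    rintro _ ⟨t, ht, rfl⟩
    rw [image_prefixMap]
    exact (measurableSet_cylinder a).inter (measurable_shift _ ht)

/-- The image of `E` under `σ_a` is `Z(a) ∩ σ^{-d(a)}(E)`. In this form, absolute continuity can be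
carried through restriction and pushforward. -/
theorem compMeasure_prefixMap (ν : Measure Λ.InfPath) (a : Λ.Path) :
    compMeasure ν (Λ.prefixMap a) = (ν.restrict (Λ.cylinder a)).map (Λ.shift (Λ.d a)) := by
  ext E hE
  rw [compMeasure, Measure.map_apply measurable_subtype_coe hE,
    (measurableEmbedding_prefixMap a).comap_apply, image_prefixMap,
    Measure.map_apply (measurable_shift _) hE, Measure.restrict_apply (measurable_shift _ hE),
    inter_comm]

theorem prefixMap_ident (v : Λ.Vertex) (x : Λ.prefixDomain (Λ.ident v)) :
    Λ.prefixMap (Λ.ident v) x = x := by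
  have h := shift_prefixMap (Λ.ident v) x
  rwa [Λ.d_ident, shift_zero] at h

theorem prefixMap_comp (a b : Λ.Path) (h : Λ.s a = Λ.r b) (x : Λ.InfPath)
    (h1 : x ∈ Λ.prefixDomain b) (h2 : Λ.prefixMap b ⟨x, h1⟩ ∈ Λ.prefixDomain a)
    (h3 : x ∈ Λ.prefixDomain (Λ.comp a b h)) :
    Λ.prefixMap a ⟨Λ.prefixMap b ⟨x, h1⟩, h2⟩ = Λ.prefixMap (Λ.comp a b h) ⟨x, h3⟩ := by
  refine eq_of_mem_cylinder_of_shift_eq ?_ (prefixMap_mem_cylinder _ _) ?_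
  · rw [cylinder_comp]
    refine ⟨prefixMap_mem_cylinder _ _, ?_⟩
    rw [mem_preimage, shift_prefixMap]
    exact prefixMap_mem_cylinder _ _
  · rw [shift_prefixMap, shift_d_comp, shift_prefixMap, shift_prefixMap]

theorem mem_cylinder_toFun_zero (x : Λ.InfPath) (m : Fin k → ℕ) :
    x ∈ Λ.cylinder (x.toFun 0 m zero_le) :=
  x.toFun_congr _ rfl (by rw [x.d_toFun, tsub_zero])

theorem eq_of_mem_cylinder {a b : Λ.Path} {x : Λ.InfPath} (ha : x ∈ Λ.cylinder a)
    (hb : x ∈ Λ.cylinder b) (h : Λ.d a = Λ.d b) : a = b := by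
  rw [← InfPath.mem_cylinder.1 ha, ← InfPath.mem_cylinder.1 hb]
  exact x.toFun_congr _ rfl h

end KGraph

/-! ### The semibranching system for measures equivalent to `M`. -/

theorem flip_s_eq_r (a b : flipGraph.Path) : flipGraph.s a = flipGraph.r b := rfl

theorem flip_prefixDomain (a : flipGraph.Path) : flipGraph.prefixDomain a = univ :=
  flip_cylinder_ident

/-- A measure on the path space which is quasi-invariant under the prefixing maps gives a
`Λ`-semibranching function system. -/
theorem flip_standardSystem {ν : Measure flipGraph.InfPath} [IsProbabilityMeasure ν]
    (h1 : ∀ a, compMeasure ν (flipGraph.prefixMap a) ≪ ν)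
    (h2 : ∀ a, ν ≪ compMeasure ν (flipGraph.prefixMap a)) : flipGraph.StandardSystem ν where
  semibranching m :=
    { measurable_domain := fun a => measurableSet_cylinder _
      measurable_map := fun a => measurable_prefixMap _
      cover := by
        have : (⋃ a : {a : flipGraph.Path // flipGraph.d a = m},
            range (flipGraph.prefixMap a.1)) = univ := by
          refine eq_univ_of_forall fun x => mem_iUnion.2 ?_
          refine ⟨⟨x.toFun 0 m zero_le, by rw [x.d_toFun, tsub_zero]⟩, ?_⟩
          rw [range_prefixMap]
          exact mem_cylinder_toFun_zero x m
        rw [this, compl_univ, measure_empty]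
      disjoint := by
        intro a b hab
        have : range (flipGraph.prefixMap a.1) ∩ range (flipGraph.prefixMap b.1) = ∅ := by
          rw [range_prefixMap, range_prefixMap]
          refine eq_empty_of_forall_notMem fun x hx => hab ?_
          exact Subtype.ext (eq_of_mem_cylinder hx.1 hx.2 (a.2.trans b.2.symm))
        rw [this, measure_empty]
      comp_measure := by
        intro a E hE _
        rw [compMeasure, Measure.map_apply measurable_subtype_coe hE,
          (measurableEmbedding_prefixMap a.1).comap_apply]
      has_derivative := by
        intro a
        have : IsFiniteMeasure (compMeasure ν (flipGraph.prefixMap a.1)) := by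
          rw [compMeasure_prefixMap]; infer_instance
        exact (Measure.withDensity_rnDeriv_eq _ _ (h1 a)).symm
      derivative_pos := by
        intro a
        have : IsFiniteMeasure (compMeasure ν (flipGraph.prefixMap a.1)) := by
          rw [compMeasure_prefixMap]; infer_instance
        filter_upwards [Measure.rnDeriv_pos' (h2 a)] with x hx _ using hx }
  coding m :=
    { measurable := measurable_shift m
      left_inv := by
        rintro ⟨a, rfl⟩ x
        exact shift_prefixMap a x }
  vertex_id v x := prefixMap_ident v x
  vertex_pos v := by rw [flip_prefixDomain, measure_univ]; exact one_pos
  range_subset a b _ := by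
    have : range (flipGraph.prefixMap b) \ flipGraph.prefixDomain a = ∅ := by
      rw [sdiff_eq_empty, flip_prefixDomain a]
      exact subset_univ _
    rw [this, measure_empty]
  comp_domain a b h := by simp only [flip_prefixDomain, mem_univ, Filter.eventually_true]
  comp_map a b h := Filter.Eventually.of_forall fun x h1 h2 h3 => prefixMap_comp a b h x h1 h2 h3
  coding_comp m n := InfPath.shift_comp m n

theorem perronFrobenius_cylinder {M : Measure flipGraph.InfPath}
    (hM : flipGraph.IsPerronFrobeniusMeasure M)
    (a : flipGraph.Path) :
    M (flipGraph.cylinder a) = (2⁻¹ : ℝ≥0∞) ^ (blueWord a).length := by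
  rw [isPerronFrobeniusMeasure_iff] at hM
  rw [hM, Finset.prod_const, Finset.card_univ, Fintype.card_fin,
    ENNReal.ofReal_pow (by norm_num), one_div, ENNReal.ofReal_inv_of_pos two_pos,
    ENNReal.ofReal_ofNat]

/-- On cylinders this is `M(Z(ab)) = 2^{-|a|} M(Z(b))`, with `|a|` the blue length; the swaps in the
word of `ab` do not affect its length. -/
theorem perronFrobenius_map_shift {M : Measure flipGraph.InfPath}
    (hM : flipGraph.IsPerronFrobeniusMeasure M)
    (a : flipGraph.Path) :
    (M.restrict (flipGraph.cylinder a)).map (flipGraph.shift (flipGraph.d a)) =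
      (2⁻¹ : ℝ≥0∞) ^ (blueWord a).length • M := by
  have : IsProbabilityMeasure M := ((isPerronFrobeniusMeasure_iff M).1 hM).isProbabilityMeasure
  refine flip_measure_ext fun b => ?_
  rw [Measure.map_apply (measurable_shift _) (measurableSet_cylinder b),
    Measure.restrict_apply (measurable_shift _ (measurableSet_cylinder b)), inter_comm,
    ← cylinder_comp a b (flip_s_eq_r a b), Measure.smul_apply, smul_eq_mul,
    perronFrobenius_cylinder hM, perronFrobenius_cylinder hM, ← pow_add,
    blueWord_comp, List.length_append, List.length_map]

/-- Replacing `ν` by `M` preserves null sets under restriction and pushforward, and for `M` the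
composed measure is a nonzero multiple of `M`. -/
theorem compMeasure_equivalent {M : Measure flipGraph.InfPath}
    (hM : flipGraph.IsPerronFrobeniusMeasure M)
    {ν : Measure flipGraph.InfPath} (h1 : ν ≪ M) (h2 : M ≪ ν)
    (a : flipGraph.Path) :
    compMeasure ν (flipGraph.prefixMap a) ≪ ν ∧ ν ≪ compMeasure ν (flipGraph.prefixMap a) := by
  have e := perronFrobenius_map_shift hM a
  rw [compMeasure_prefixMap]
  have hne : (2⁻¹ : ℝ≥0∞) ^ (blueWord a).length ≠ 0 := by simp
  constructor
  · refine Measure.AbsolutelyContinuous.trans ((h1.restrict _).map (measurable_shift _)) ?_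
    rw [e]
    exact Measure.smul_absolutelyContinuous.trans h2
  · refine Measure.AbsolutelyContinuous.trans ?_ ((h2.restrict _).map (measurable_shift _))
    rw [e]
    exact h1.trans (Measure.absolutelyContinuous_smul hne)

theorem standardSystem_of_equivalent {M : Measure flipGraph.InfPath}
    (hM : flipGraph.IsPerronFrobeniusMeasure M)
    {ν : Measure flipGraph.InfPath} [IsProbabilityMeasure ν]
    (h1 : ν ≪ M) (h2 : M ≪ ν) : flipGraph.StandardSystem ν :=
  flip_standardSystem (fun a => (compMeasure_equivalent hM h1 h2 a).1)
    fun a => (compMeasure_equivalent hM h1 h2 a).2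

/-! ### Weighted composition operators between `L²` spaces. -/

section WeightedComposition

variable {X Y : Type*} [MeasurableSpace X] [MeasurableSpace Y] {μ : Measure X} {ν : Measure Y}

/-- The weight `g` and the map `T` satisfy `T_*(|g|² ν) = μ`, so that `ξ ↦ g · (ξ ∘ T)` is
isometric from `L²(μ)` to `L²(ν)`. -/
structure IsWeightedComp (μ : Measure X) (ν : Measure Y) (g : Y → ℝ) (T : Y → X) : Prop where
  measurable_weight : Measurable g
  measurable_map : Measurable T
  map_eq : (ν.withDensity fun y => ‖g y‖ₑ ^ 2).map T = μ

namespace IsWeightedComp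

variable {g : Y → ℝ} {T : Y → X}

theorem measurable_density (h : IsWeightedComp μ ν g T) : Measurable fun y => ‖g y‖ₑ ^ 2 :=
  h.measurable_weight.enorm.pow_const 2

/-- `T` need not pull `μ`-null sets back to `ν`-null sets where `g` vanishes, but there `g · (ξ ∘
T)` is zero whatever `ξ` is; hence the restriction to `g y ≠ 0`. -/
theorem ae (h : IsWeightedComp μ ν g T) {p : X → Prop} (hp : ∀ᵐ x ∂μ, p x) :
    ∀ᵐ y ∂ν, g y ≠ 0 → p (T y) := by
  rw [← h.map_eq] at hp
  have := ae_of_ae_map h.measurable_map.aemeasurable hp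
  rw [ae_withDensity_iff h.measurable_density] at this
  filter_upwards [this] with y hy hg
  exact hy (by simpa using hg)

theorem congr_ae (h : IsWeightedComp μ ν g T) {ξ ξ' : X → ℂ} (hξ : ξ =ᵐ[μ] ξ') :
    (fun y => (g y : ℂ) * ξ (T y)) =ᵐ[ν] fun y => (g y : ℂ) * ξ' (T y) := by
  filter_upwards [h.ae hξ] with y hy
  by_cases hg : g y = 0
  · simp [hg]
  · rw [hy hg]

theorem aestronglyMeasurable (h : IsWeightedComp μ ν g T) {ξ : X → ℂ}
    (hξ : AEStronglyMeasurable ξ μ) :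
    AEStronglyMeasurable (fun y => (g y : ℂ) * ξ (T y)) ν := by
  obtain ⟨ξ', hξ', e⟩ := hξ
  refine AEStronglyMeasurable.congr ?_ (h.congr_ae e).symm
  exact ((Complex.measurable_ofReal.comp h.measurable_weight).mul
    (hξ'.measurable.comp h.measurable_map)).aestronglyMeasurable

theorem eLpNorm_eq (h : IsWeightedComp μ ν g T) {ξ : X → ℂ} (hξ : AEStronglyMeasurable ξ μ) :
    eLpNorm (fun y => (g y : ℂ) * ξ (T y)) 2 ν = eLpNorm ξ 2 μ := by
  obtain ⟨ξ', hξ', e⟩ := hξ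
  rw [eLpNorm_congr_ae (h.congr_ae e), eLpNorm_congr_ae e,
    eLpNorm_eq_lintegral_rpow_enorm_toReal two_ne_zero ENNReal.ofNat_ne_top,
    eLpNorm_eq_lintegral_rpow_enorm_toReal two_ne_zero ENNReal.ofNat_ne_top]
  congr 1
  simp only [ENNReal.toReal_ofNat, ENNReal.rpow_ofNat]
  have hm : Measurable fun x => ‖ξ' x‖ₑ ^ 2 := hξ'.measurable.enorm.pow_const 2
  rw [← h.map_eq, lintegral_map hm h.measurable_map,
    lintegral_withDensity_eq_lintegral_mul _ h.measurable_density
      (g := fun y => ‖ξ' (T y)‖ₑ ^ 2) (hm.comp h.measurable_map)]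
  refine lintegral_congr fun y => ?_
  simp only [enorm_mul, mul_pow, Pi.mul_apply]
  congr 2
  rw [← ofReal_norm, ← ofReal_norm, Complex.norm_real]

theorem memLp (h : IsWeightedComp μ ν g T) {ξ : X → ℂ} (hξ : MemLp ξ 2 μ) :
    MemLp (fun y => (g y : ℂ) * ξ (T y)) 2 ν :=
  ⟨h.aestronglyMeasurable hξ.1, by rw [h.eLpNorm_eq hξ.1]; exact hξ.2⟩

/-- The isometry `ξ ↦ g · (ξ ∘ T)` from `L²(μ)` to `L²(ν)`. -/
noncomputable def isometry (h : IsWeightedComp μ ν g T) : Lp ℂ 2 μ →ₗᵢ[ℂ] Lp ℂ 2 ν where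
  toFun ξ := (h.memLp (Lp.memLp ξ)).toLp _
  map_add' ξ η := by
    rw [← MemLp.toLp_add]
    refine MemLp.toLp_congr _ _ ((h.congr_ae (Lp.coeFn_add ξ η)).trans ?_)
    exact Filter.Eventually.of_forall fun y => mul_add _ _ _
  map_smul' c ξ := by
    rw [RingHom.id_apply, ← MemLp.toLp_const_smul]
    refine MemLp.toLp_congr _ _ ((h.congr_ae (Lp.coeFn_smul c ξ)).trans ?_)
    exact Filter.Eventually.of_forall fun y => mul_left_comm _ _ _
  norm_map' ξ := by
    refine (Lp.norm_toLp _ (h.memLp (Lp.memLp ξ))).trans ?_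
    rw [ h.eLpNorm_eq (Lp.aestronglyMeasurable ξ), Lp.norm_def]

theorem coeFn_isometry (h : IsWeightedComp μ ν g T) (ξ : Lp ℂ 2 μ) :
    (h.isometry ξ : Y → ℂ) =ᵐ[ν] fun y => (g y : ℂ) * ξ (T y) :=
  MemLp.coeFn_toLp (h.memLp (Lp.memLp ξ))

end IsWeightedComp

end WeightedComposition

/-! ### Equivalent measures and multiplication by the square root of the density. -/

section Density

variable {X : Type*} [MeasurableSpace X] {M ν : Measure X}

theorem exists_pos_density [SigmaFinite M] [IsFiniteMeasure ν] (h1 : ν ≪ M) (h2 : M ≪ ν) :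
    ∃ h : X → ℝ, Measurable h ∧ (∀ x, 0 < h x) ∧
      ν = M.withDensity fun x => ENNReal.ofReal (h x) := by
  -- Redefining the derivative as `1` on the null set where it is `0` or `∞` makes it real and
  -- positive everywhere, so later divisions need no exceptional set.
  refine ⟨fun x => if 0 < (ν.rnDeriv M x).toReal then (ν.rnDeriv M x).toReal else 1, ?_, ?_, ?_⟩
  · have hm : Measurable fun x => (ν.rnDeriv M x).toReal :=
      (Measure.measurable_rnDeriv ν M).ennreal_toReal
    exact Measurable.ite (measurableSet_lt measurable_const hm) hm measurable_const
  · intro x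
    dsimp only
    split_ifs with h
    · exact h
    · exact one_pos
  · conv_lhs => rw [← Measure.withDensity_rnDeriv_eq ν M h1]
    refine withDensity_congr_ae ?_
    filter_upwards [Measure.rnDeriv_pos' h2, Measure.rnDeriv_lt_top ν M] with x hx hx'
    rw [if_pos (ENNReal.toReal_pos hx.ne' hx'.ne), ENNReal.ofReal_toReal hx'.ne]

variable {h : X → ℝ}

theorem enorm_sqrt_sq {c : ℝ} (hc : 0 ≤ c) : ‖√c‖ₑ ^ 2 = ENNReal.ofReal c := by
  rw [← ofReal_norm, Real.norm_of_nonneg (Real.sqrt_nonneg _),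
    ← ENNReal.ofReal_pow (Real.sqrt_nonneg _), Real.sq_sqrt hc]

theorem isWeightedComp_sqrt (hm : Measurable h) (hpos : ∀ x, 0 < h x)
    (hν : ν = M.withDensity fun x => ENNReal.ofReal (h x)) :
    IsWeightedComp ν M (fun x => √(h x)) id where
  measurable_weight := hm.sqrt
  measurable_map := measurable_id
  map_eq := by
    rw [Measure.map_id, hν]
    congr 1
    funext x
    exact enorm_sqrt_sq (hpos x).le

theorem isWeightedComp_sqrt_inv (hm : Measurable h) (hpos : ∀ x, 0 < h x)
    (hν : ν = M.withDensity fun x => ENNReal.ofReal (h x)) :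
    IsWeightedComp M ν (fun x => √(h x)⁻¹) id where
  measurable_weight := hm.inv.sqrt
  measurable_map := measurable_id
  map_eq := by
    have e : (fun x => ‖√(h x)⁻¹‖ₑ ^ 2) = fun x => ENNReal.ofReal (h x)⁻¹ :=
      funext fun x => enorm_sqrt_sq (inv_pos.2 (hpos x)).le
    rw [Measure.map_id, hν, e, ← withDensity_mul _ hm.ennreal_ofReal
      (g := fun x => ENNReal.ofReal (h x)⁻¹) hm.inv.ennreal_ofReal]
    convert! withDensity_one
    funext x
    rw [Pi.mul_apply, ← ENNReal.ofReal_mul (hpos x).le, mul_inv_cancel₀ (hpos x).ne',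
      ENNReal.ofReal_one, Pi.one_apply]

/-- Equivalent measures have unitarily equivalent `L²` spaces, by multiplication with the square
root of the density. -/
theorem exists_sqrt_unitary (hm : Measurable h) (hpos : ∀ x, 0 < h x)
    (hν : ν = M.withDensity fun x => ENNReal.ofReal (h x)) :
    ∃ U : Lp ℂ 2 ν ≃ₗᵢ[ℂ] Lp ℂ 2 M,
      ∀ ξ, (U ξ : X → ℂ) =ᵐ[M] fun x => (√(h x) : ℂ) * ξ x := by
  have hA := isWeightedComp_sqrt hm hpos hν
  have hB := isWeightedComp_sqrt_inv hm hpos hν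
  refine ⟨LinearIsometryEquiv.ofSurjective hA.isometry fun η => ⟨hB.isometry η, ?_⟩,
    fun ξ => hA.coeFn_isometry ξ⟩
  refine Lp.ext ((hA.coeFn_isometry _).trans ((hA.congr_ae (hB.coeFn_isometry η)).trans ?_))
  refine Filter.Eventually.of_forall fun x => ?_
  simp only [id]
  rw [← mul_assoc, ← Complex.ofReal_mul, ← Real.sqrt_mul (hpos x).le,
    mul_inv_cancel₀ (hpos x).ne', Real.sqrt_one, Complex.ofReal_one, one_mul]

end Density

/-! ### The Cuntz–Krieger family on `L²(M)`. -/

/-- The function `2^{|w|/2} χ_{Z(w e^n)}`. -/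
noncomputable def shiftWeight (a : flipGraph.Path) : flipGraph.InfPath → ℝ :=
  (flipGraph.cylinder a).indicator fun _ => √2 ^ (blueWord a).length

theorem shiftWeight_of_mem {a : flipGraph.Path} {x : flipGraph.InfPath}
    (hx : x ∈ flipGraph.cylinder a) : shiftWeight a x = √2 ^ (blueWord a).length :=
  indicator_of_mem hx _

theorem shiftWeight_of_notMem {a : flipGraph.Path} {x : flipGraph.InfPath}
    (hx : x ∉ flipGraph.cylinder a) : shiftWeight a x = 0 :=
  indicator_of_notMem hx _

theorem isWeightedComp_shift {M : Measure flipGraph.InfPath}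
    (hM : flipGraph.IsPerronFrobeniusMeasure M) (a : flipGraph.Path) :
    IsWeightedComp M M (shiftWeight a) (flipGraph.shift (flipGraph.d a)) where
  measurable_weight := measurable_const.indicator (measurableSet_cylinder a)
  measurable_map := measurable_shift _
  map_eq := by
    have e : (fun x => ‖shiftWeight a x‖ₑ ^ 2) =
        (flipGraph.cylinder a).indicator fun _ => (2 : ℝ≥0∞) ^ (blueWord a).length := by
      funext x
      by_cases hx : x ∈ flipGraph.cylinder a
      · rw [shiftWeight_of_mem hx, indicator_of_mem hx, enorm_pow, ← pow_mul, mul_comm, pow_mul,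
          enorm_sqrt_sq zero_le_two, ENNReal.ofReal_ofNat]
      · rw [shiftWeight_of_notMem hx, indicator_of_notMem hx]
        simp
    rw [e, withDensity_indicator (measurableSet_cylinder a), withDensity_const, Measure.map_smul,
      perronFrobenius_map_shift hM, smul_smul, ← mul_pow,
      ENNReal.mul_inv_cancel two_ne_zero ENNReal.ofNat_ne_top, one_pow, one_smul]

/-- The operators `S_a ξ = 2^{|w|/2} χ_{Z(a)} · (ξ ∘ σ^{d(a)})`, `a = w e^n`, on `L²(M)`. -/
noncomputable def shiftOp {M : Measure flipGraph.InfPath}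
    (hM : flipGraph.IsPerronFrobeniusMeasure M) (a : flipGraph.Path) :
    Lp ℂ 2 M →L[ℂ] Lp ℂ 2 M :=
  (isWeightedComp_shift hM a).isometry.toContinuousLinearMap

theorem norm_shiftOp {M : Measure flipGraph.InfPath}
    (hM : flipGraph.IsPerronFrobeniusMeasure M) (a : flipGraph.Path) (ξ : Lp ℂ 2 M) :
    ‖shiftOp hM a ξ‖ = ‖ξ‖ := (isWeightedComp_shift hM a).isometry.norm_map ξ

theorem coeFn_shiftOp {M : Measure flipGraph.InfPath}
    (hM : flipGraph.IsPerronFrobeniusMeasure M) (a : flipGraph.Path) (ξ : Lp ℂ 2 M) :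
    (shiftOp hM a ξ : flipGraph.InfPath → ℂ) =ᵐ[M]
      fun x => (shiftWeight a x : ℂ) * ξ (flipGraph.shift (flipGraph.d a) x) :=
  (isWeightedComp_shift hM a).coeFn_isometry ξ

theorem shiftWeight_comp (a b : flipGraph.Path) (h) (x : flipGraph.InfPath) :
    shiftWeight (flipGraph.comp a b h) x =
      shiftWeight a x * shiftWeight b (flipGraph.shift (flipGraph.d a) x) := by
  by_cases ha : x ∈ flipGraph.cylinder a
  · by_cases hb : flipGraph.shift (flipGraph.d a) x ∈ flipGraph.cylinder b
    · have : x ∈ flipGraph.cylinder (flipGraph.comp a b h) := by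
        rw [cylinder_comp]; exact ⟨ha, hb⟩
      rw [shiftWeight_of_mem this, shiftWeight_of_mem ha, shiftWeight_of_mem hb, blueWord_comp,
        List.length_append, List.length_map, pow_add]
    · have : x ∉ flipGraph.cylinder (flipGraph.comp a b h) := by
        rw [cylinder_comp]; exact fun h => hb h.2
      rw [shiftWeight_of_notMem this, shiftWeight_of_notMem hb, mul_zero]
  · have : x ∉ flipGraph.cylinder (flipGraph.comp a b h) := by
      rw [cylinder_comp]; exact fun h => ha h.1
    rw [shiftWeight_of_notMem this, shiftWeight_of_notMem ha, zero_mul]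

theorem shiftOp_mul {M : Measure flipGraph.InfPath} (hM : flipGraph.IsPerronFrobeniusMeasure M)
    (a b : flipGraph.Path) (h) :
    shiftOp hM a * shiftOp hM b = shiftOp hM (flipGraph.comp a b h) := by
  ext1 ξ
  refine Lp.ext ?_
  refine (coeFn_shiftOp hM a _).trans ?_
  refine ((isWeightedComp_shift hM a).congr_ae (coeFn_shiftOp hM b ξ)).trans ?_
  refine Filter.EventuallyEq.trans ?_ (coeFn_shiftOp hM _ ξ).symm
  refine Filter.Eventually.of_forall fun x => ?_
  simp only [shiftWeight_comp, shift_d_comp, Complex.ofReal_mul, mul_assoc]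

theorem shiftOp_ident {M : Measure flipGraph.InfPath}
    (hM : flipGraph.IsPerronFrobeniusMeasure M) (v : flipGraph.Vertex) :
    shiftOp hM (flipGraph.ident v) = 1 := by
  ext1 ξ
  refine Lp.ext ((coeFn_shiftOp hM _ ξ).trans ?_)
  refine Filter.Eventually.of_forall fun x => ?_
  have hx : x ∈ flipGraph.cylinder (flipGraph.ident v) :=
    flip_cylinder_ident ▸ mem_univ x
  have hl : (blueWord (flipGraph.ident v)).length = 0 := rfl
  simp only [shiftWeight_of_mem hx, hl, pow_zero, Complex.ofReal_one, one_mul, flipGraph.d_ident,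
    shift_zero, one_apply_eq_self]

theorem star_shiftOp_mul {M : Measure flipGraph.InfPath}
    (hM : flipGraph.IsPerronFrobeniusMeasure M) (a : flipGraph.Path) :
    star (shiftOp hM a) * shiftOp hM a = 1 :=
  (ContinuousLinearMap.norm_map_iff_adjoint_comp_self _).1 (norm_shiftOp hM a)

/-- The prefixing map `σ_a`, as a map on all of the path space. -/
noncomputable def flipPrefix (a : flipGraph.Path) (x : flipGraph.InfPath) : flipGraph.InfPath :=
  flipGraph.prefixMap a ⟨x, flip_prefixDomain a ▸ mem_univ x⟩

theorem measurable_flipPrefix (a : flipGraph.Path) : Measurable (flipPrefix a) :=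
  (measurable_prefixMap a).comp (measurable_id.subtype_mk)

theorem flipPrefix_shift {a : flipGraph.Path} {x : flipGraph.InfPath}
    (hx : x ∈ flipGraph.cylinder a) : flipPrefix a (flipGraph.shift (flipGraph.d a) x) = x :=
  prefixMap_shift hx

/-- Write `M` as the rescaled image of its restriction to `Z(a)` under the shift; prefixing by `a`
undoes the shift on `Z(a)`. -/
theorem perronFrobenius_map_flipPrefix {M : Measure flipGraph.InfPath}
    (hM : flipGraph.IsPerronFrobeniusMeasure M) (a : flipGraph.Path) :
    M.map (flipPrefix a) =
      (2 : ℝ≥0∞) ^ (blueWord a).length • M.restrict (flipGraph.cylinder a) := by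
  have h : M = (2 : ℝ≥0∞) ^ (blueWord a).length •
      (M.restrict (flipGraph.cylinder a)).map (flipGraph.shift (flipGraph.d a)) := by
    rw [perronFrobenius_map_shift hM, smul_smul, ← mul_pow,
      ENNReal.mul_inv_cancel two_ne_zero ENNReal.ofNat_ne_top, one_pow, one_smul]
  conv_lhs => rw [h]
  rw [Measure.map_smul, Measure.map_map (measurable_flipPrefix a) (measurable_shift _)]
  congr 1
  have : flipPrefix a ∘ flipGraph.shift (flipGraph.d a) =ᵐ[M.restrict (flipGraph.cylinder a)]
      id := by
    filter_upwards [ae_restrict_mem (measurableSet_cylinder a)] with x hx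
    exact flipPrefix_shift hx
  rw [Measure.map_congr this, Measure.map_id]

/-- The preimage is `η = 2^{-|w|/2} ξ ∘ σ_a`. Hence the range of `S_a` contains every function of
`L²(M)` supported on `Z(a)`. -/
theorem exists_shiftOp_eq_indicator {M : Measure flipGraph.InfPath}
    (hM : flipGraph.IsPerronFrobeniusMeasure M) (a : flipGraph.Path) (ξ : Lp ℂ 2 M) :
    ∃ η : Lp ℂ 2 M, (shiftOp hM a η : flipGraph.InfPath → ℂ) =ᵐ[M]
      (flipGraph.cylinder a).indicator ξ := by
  have hne : (√2 : ℂ) ^ (blueWord a).length ≠ 0 :=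
    pow_ne_zero _ (Complex.ofReal_ne_zero.2 (Real.sqrt_ne_zero'.2 two_pos))
  have h1 : MemLp ξ 2 (M.map (flipPrefix a)) := by
    rw [perronFrobenius_map_flipPrefix hM]
    exact (Lp.memLp ξ).restrict _ |>.smul_measure (by simp)
  have h2 := (h1.comp_of_map (measurable_flipPrefix a).aemeasurable).const_mul
    ((√2 : ℂ) ^ (blueWord a).length)⁻¹
  refine ⟨h2.toLp _, (coeFn_shiftOp hM a _).trans ?_⟩
  refine ((isWeightedComp_shift hM a).congr_ae h2.coeFn_toLp).trans ?_
  refine Filter.Eventually.of_forall fun x => ?_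
  by_cases hx : x ∈ flipGraph.cylinder a
  · simp only [shiftWeight_of_mem hx, indicator_of_mem hx, Function.comp, flipPrefix_shift hx]
    rw [Complex.ofReal_pow, mul_inv_cancel_left₀ hne]
  · simp only [shiftWeight_of_notMem hx, indicator_of_notMem hx, Complex.ofReal_zero, zero_mul]

/-- With `χ_{Z(a)} ξ = S_a η`, the difference `ξ - S_a η` lives off `Z(a)` and is orthogonal to the
range of `S_a`, so `S_a^*` kills it; then `S_a^* S_a = 1` gives `S_a^* ξ = η`. No formula for the
adjoint is needed. -/
theorem coeFn_shiftOp_mul_star {M : Measure flipGraph.InfPath}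
    (hM : flipGraph.IsPerronFrobeniusMeasure M) (a : flipGraph.Path) (ξ : Lp ℂ 2 M) :
    ((shiftOp hM a * star (shiftOp hM a)) ξ : flipGraph.InfPath → ℂ) =ᵐ[M]
      (flipGraph.cylinder a).indicator ξ := by
  obtain ⟨η, hη⟩ := exists_shiftOp_eq_indicator hM a ξ
  have h0 : star (shiftOp hM a) (ξ - shiftOp hM a η) = 0 := by
    refine ext_inner_left ℂ fun ζ => ?_
    rw [ContinuousLinearMap.star_eq_adjoint, ContinuousLinearMap.adjoint_inner_right,
      inner_zero_right, L2.inner_def]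
    refine integral_eq_zero_of_ae ?_
    filter_upwards [coeFn_shiftOp hM a ζ, Lp.coeFn_sub ξ (shiftOp hM a η), hη] with x h1 h2 h3
    rw [h1, h2, Pi.sub_apply, h3]
    by_cases hx : x ∈ flipGraph.cylinder a
    · rw [indicator_of_mem hx, sub_self, inner_zero_right]; rfl
    · rw [shiftWeight_of_notMem hx, Complex.ofReal_zero, zero_mul, inner_zero_left]; rfl
  have h1 : star (shiftOp hM a) (shiftOp hM a η) = η :=
    congrArg (fun A : Lp ℂ 2 M →L[ℂ] Lp ℂ 2 M => A η) (star_shiftOp_mul hM a)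
  rw [map_sub, h1, sub_eq_zero] at h0
  rw [mul_apply_eq_comp, h0]
  exact hη

instance finite_flip_paths (v : flipGraph.Vertex) (n : Fin 2 → ℕ) :
    Finite {a : flipGraph.Path // flipGraph.r a = v ∧ flipGraph.d a = n} := by
  have := (List.finite_length_eq (Fin 2) (n 0)).to_subtype
  refine Finite.of_injective (β := {l : List (Fin 2) | l.length = n 0})
    (fun a => ⟨blueWord a.1, by rw [mem_ofPred_eq, length_blueWord, a.2.2]⟩) fun a b h => ?_
  refine Subtype.ext (flip_path_ext (congrArg Subtype.val h) ?_)
  rw [redCount_eq, redCount_eq, a.2.2, b.2.2]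

theorem isCuntzKrieger_shiftOp {M : Measure flipGraph.InfPath}
    (hM : flipGraph.IsPerronFrobeniusMeasure M) : flipGraph.IsCuntzKrieger (shiftOp hM) where
  projection v := by rw [shiftOp_ident]; exact IsStarProjection.one _
  orthogonal v w h := absurd (Subsingleton.elim (α := Unit) v w) h
  mul a b h := shiftOp_mul hM a b h
  star_mul a := by rw [shiftOp_ident, star_shiftOp_mul]
  sum v n := by
    have := Fintype.ofFinite {a : flipGraph.Path // flipGraph.r a = v ∧ flipGraph.d a = n}
    rw [shiftOp_ident, finsum_eq_sum_of_fintype]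
    ext1 ξ
    rw [sum_apply, one_apply_eq_self]
    refine Lp.ext (Filter.EventuallyEq.symm ((Lp.coeFn_fun_finsetSum _ _).trans ?_))
    have hall := (ae_all_iff
      (ι := {a : flipGraph.Path // flipGraph.r a = v ∧ flipGraph.d a = n})).2
      fun a => coeFn_shiftOp_mul_star hM a.1 ξ
    filter_upwards [hall] with x hx
    simp only [hx]
    -- The cylinders of degree `n` partition the path space, so at `x` only the term of the initial
    -- segment `x(0, n)` survives.
    let a₀ : {a : flipGraph.Path // flipGraph.r a = v ∧ flipGraph.d a = n} :=
      ⟨x.toFun 0 n zero_le, rfl, by rw [x.d_toFun, tsub_zero]⟩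
    rw [Finset.sum_eq_single a₀]
    · exact indicator_of_mem (mem_cylinder_toFun_zero x n) _
    · intro b _ hb
      refine indicator_of_notMem (fun h => hb ?_) _
      exact Subtype.ext (eq_of_mem_cylinder h (mem_cylinder_toFun_zero x n)
        (b.2.2.trans a₀.2.2.symm))
    · exact fun h => absurd (Finset.mem_univ _) h

/-- In finite dimension the isometry `S_{f_1}` would be onto. Its range consists of functions
vanishing off `Z(f_1)`, so it misses the constant `1`, as `Z(f_2)` has measure `1/2`. Infinite
dimension is what allows the passage to `ℓ²(ℕ)`. -/
theorem not_finiteDimensional_L2 {M : Measure flipGraph.InfPath}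
    (hM : flipGraph.IsPerronFrobeniusMeasure M) : ¬ FiniteDimensional ℂ (Lp ℂ 2 M) := by
  intro hfin
  have : IsProbabilityMeasure M := ((isPerronFrobeniusMeasure_iff M).1 hM).isProbabilityMeasure
  have hsurj : Function.Surjective (shiftOp hM (flipF 0)) :=
    LinearMap.injective_iff_surjective (f := (shiftOp hM (flipF 0)).toLinearMap).1
      (isWeightedComp_shift hM (flipF 0)).isometry.injective
  obtain ⟨η, hη⟩ := hsurj ((memLp_const (1 : ℂ)).toLp _)
  have h1 := coeFn_shiftOp hM (flipF 0) η
  rw [hη] at h1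
  replace h1 := h1.symm.trans (memLp_const (1 : ℂ)).coeFn_toLp
  have h2 : ∀ᵐ x ∂M, x ∉ flipGraph.cylinder (flipF 1) := by
    filter_upwards [h1] with x hx h
    have hn : x ∉ flipGraph.cylinder (flipF 0) := fun h0 =>
      absurd (congrArg blueWord (eq_of_mem_cylinder h h0 rfl)) (by simp [blueWord, flipF])
    rw [shiftWeight_of_notMem hn, Complex.ofReal_zero, zero_mul] at hx
    exact zero_ne_one hx
  have h3 : M (flipGraph.cylinder (flipF 1)) = 0 := by
    simpa [ae_iff] using h2
  rw [perronFrobenius_cylinder hM] at h3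
  simp at h3

/-! ### Standard representations and their unitary equivalence. -/

/-- For `ν = h M` this gives the derivative `Φ_{σ_a} = 2^{-|w|} (h ∘ σ_a) / h`, by the change of
variables `x = σ_a(y)`, under which `M` scales by `2^{-|w|}`. -/
theorem compMeasure_prefixMap_withDensity {M : Measure flipGraph.InfPath}
    (hM : flipGraph.IsPerronFrobeniusMeasure M) {h : flipGraph.InfPath → ℝ} (hm : Measurable h)
    (hpos : ∀ x, 0 < h x) (a : flipGraph.Path) :
    compMeasure (M.withDensity fun x => ENNReal.ofReal (h x)) (flipGraph.prefixMap a) =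
      (M.withDensity fun x => ENNReal.ofReal (h x)).withDensity fun y =>
        ENNReal.ofReal (2⁻¹ ^ (blueWord a).length * h (flipPrefix a y) / h y) := by
  have hmp : Measurable fun y => h (flipPrefix a y) := hm.comp (measurable_flipPrefix a)
  rw [compMeasure_prefixMap, restrict_withDensity (measurableSet_cylinder a),
    ← withDensity_mul _ hm.ennreal_ofReal
      (g := fun y => ENNReal.ofReal (2⁻¹ ^ (blueWord a).length * h (flipPrefix a y) / h y))
      ((measurable_const.mul hmp).div hm).ennreal_ofReal]
  ext E hE
  have hE' := measurable_shift (flipGraph.d a) hE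
  rw [Measure.map_apply (measurable_shift _) hE, withDensity_apply _ hE',
    withDensity_apply _ hE]
  calc ∫⁻ x in flipGraph.shift (flipGraph.d a) ⁻¹' E, ENNReal.ofReal (h x)
        ∂M.restrict (flipGraph.cylinder a)
      = ∫⁻ x in flipGraph.shift (flipGraph.d a) ⁻¹' E,
          ENNReal.ofReal (h (flipPrefix a (flipGraph.shift (flipGraph.d a) x)))
          ∂M.restrict (flipGraph.cylinder a) := by
        refine lintegral_congr_ae (ae_restrict_of_ae ?_)
        filter_upwards [ae_restrict_mem (measurableSet_cylinder a)] with x hx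
        rw [flipPrefix_shift hx]
    _ = ∫⁻ y in E, ENNReal.ofReal (h (flipPrefix a y))
          ∂(2⁻¹ : ℝ≥0∞) ^ (blueWord a).length • M := by
        rw [← perronFrobenius_map_shift hM,
          setLIntegral_map hE hmp.ennreal_ofReal (measurable_shift _)]
    _ = _ := by
        rw [Measure.restrict_smul, lintegral_smul_measure, smul_eq_mul,
          ← lintegral_const_mul _ hmp.ennreal_ofReal]
        refine lintegral_congr fun y => ?_
        rw [Pi.mul_apply, ← ENNReal.ofReal_mul (hpos y).le, mul_div_cancel₀ _ (hpos y).ne',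
          ENNReal.ofReal_mul (by positivity), ENNReal.ofReal_pow (by norm_num),
          ENNReal.ofReal_inv_of_pos two_pos, ENNReal.ofReal_ofNat]

theorem density_rpow_neg_half {h₁ h₂ : ℝ} (h1 : 0 < h₁) (h2 : 0 < h₂) (n : ℕ) :
    (2⁻¹ ^ n * h₁ / h₂) ^ (-(1 / 2) : ℝ) = (√h₁)⁻¹ * (√2 ^ n * √h₂) := by
  rw [Real.rpow_neg (by positivity), ← Real.sqrt_eq_rpow, Real.sqrt_div (by positivity),
    Real.sqrt_mul (by positivity), inv_pow, Real.sqrt_inv]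
  have : √((2 : ℝ) ^ n) = √2 ^ n := by
    rw [Real.sqrt_eq_iff_mul_self_eq (by positivity) (by positivity), ← mul_pow,
      Real.mul_self_sqrt zero_le_two]
  rw [this]
  have := Real.sqrt_pos.2 h1
  have := Real.sqrt_pos.2 h2
  field_simp

/-- On `L²(ν)`, `ν` equivalent to the Perron–Frobenius measure `M`, the standard representation is
conjugate to the shift operators on `L²(M)`. -/
theorem exists_unitary_isStandardRep_iff {M ν : Measure flipGraph.InfPath}
    (hM : flipGraph.IsPerronFrobeniusMeasure M) [IsProbabilityMeasure ν]
    (h1 : ν ≪ M) (h2 : M ≪ ν) :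
    ∃ U : Lp ℂ 2 ν ≃ₗᵢ[ℂ] Lp ℂ 2 M, ∀ π, flipGraph.IsStandardRep ν π ↔
      ∀ a, π (flipGraph.gen a) = U.symm.conjStarAlgEquiv (shiftOp hM a) := by
  have : IsProbabilityMeasure M := ((isPerronFrobeniusMeasure_iff M).1 hM).isProbabilityMeasure
  obtain ⟨h, hm, hpos, hν⟩ := exists_pos_density h1 h2
  obtain ⟨U, hU⟩ := exists_sqrt_unitary hm hpos hν
  refine ⟨U, fun π => ?_⟩
  have hUsymm : ∀ η, (U.symm η : flipGraph.InfPath → ℂ) =ᵐ[ν]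
      fun x => ((√(h x))⁻¹ : ℝ) * η x := by
    intro η
    refine h1.ae_le ?_
    filter_upwards [hU (U.symm η)] with x hx
    rw [LinearIsometryEquiv.apply_symm_apply] at hx
    have : (√(h x) : ℂ) ≠ 0 := Complex.ofReal_ne_zero.2 (Real.sqrt_pos.2 (hpos x)).ne'
    rw [hx, Complex.ofReal_inv, inv_mul_cancel_left₀ this]
  have key : ∀ (a : flipGraph.Path) (ξ : Lp ℂ 2 ν),
      (U.symm.conjStarAlgEquiv (shiftOp hM a) ξ : flipGraph.InfPath → ℂ) =ᵐ[ν]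
        (range (flipGraph.prefixMap a)).indicator fun x =>
          (((rnPrefix ν (flipGraph.prefixMap a)
            (flipGraph.shift (flipGraph.d a) x)).toReal ^ (-(1 / 2) : ℝ) : ℝ) : ℂ) *
              ξ (flipGraph.shift (flipGraph.d a) x) := by
    intro a ξ
    have hrn : ∀ᵐ y ∂ν, rnPrefix ν (flipGraph.prefixMap a) y =
        ENNReal.ofReal (2⁻¹ ^ (blueWord a).length * h (flipPrefix a y) / h y) := by
      have hmeas : Measurable fun y =>
          ENNReal.ofReal (2⁻¹ ^ (blueWord a).length * h (flipPrefix a y) / h y) :=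
        ((measurable_const.mul (hm.comp (measurable_flipPrefix a))).div hm).ennreal_ofReal
      have := Measure.rnDeriv_withDensity ν hmeas
      have e := compMeasure_prefixMap_withDensity hM hm hpos a
      rw [← hν] at e
      rwa [← e] at this
    -- The formula for the derivative is needed at `σ^{d(a)}(x)` for almost every `x` in `Z(a)`; its
    -- exceptional set pulls back to a null set because `ν ∘ σ_a ≪ ν`.
    replace hrn := (compMeasure_equivalent hM h1 h2 a).1.ae_le hrn
    rw [compMeasure_prefixMap] at hrn
    replace hrn := (ae_restrict_iff' (measurableSet_cylinder a)).1
      (ae_of_ae_map (measurable_shift _).aemeasurable hrn)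
    have hS : ∀ᵐ x ∂ν, (shiftOp hM a (U ξ) : flipGraph.InfPath → ℂ) x = _ :=
      h1.ae_le ((coeFn_shiftOp hM a (U ξ)).trans ((isWeightedComp_shift hM a).congr_ae (hU ξ)))
    filter_upwards [hUsymm (shiftOp hM a (U ξ)), hS, hrn] with x hx1 hx2 hx3
    rw [LinearIsometryEquiv.conjStarAlgEquiv_apply_apply, LinearIsometryEquiv.symm_symm, hx1, hx2,
      range_prefixMap]
    by_cases hx : x ∈ flipGraph.cylinder a
    · rw [indicator_of_mem hx, hx3 hx, flipPrefix_shift hx, shiftWeight_of_mem hx,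
        ENNReal.toReal_ofReal
          (div_nonneg (mul_nonneg (by positivity) (hpos x).le) (hpos _).le),
        density_rpow_neg_half (hpos x) (hpos _)]
      push_cast
      ring
    · rw [indicator_of_notMem hx, shiftWeight_of_notMem hx]
      simp
  constructor
  · intro hπ a
    ext1 ξ
    exact Lp.ext ((hπ a ξ).trans (key a ξ).symm)
  · intro hπ a ξ
    rw [hπ a]
    exact key a ξ

theorem exists_shiftRep {M : Measure flipGraph.InfPath}
    (hM : flipGraph.IsPerronFrobeniusMeasure M) :
    ∃ π : flipGraph.cstar →⋆ₙₐ[ℂ] (Lp ℂ 2 M →L[ℂ] Lp ℂ 2 M),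
      ∀ a, π (flipGraph.gen a) = shiftOp hM a := by
  have : IsProbabilityMeasure M := ((isPerronFrobeniusMeasure_iff M).1 hM).isProbabilityMeasure
  -- A countably generated σ-algebra makes `L²(M)` separable, as the passage to `ℓ²(ℕ)` requires.
  have : MeasurableSpace.CountablyGenerated flipGraph.InfPath := by
    have := flipGraph.countable_path
    exact ⟨⟨_, countable_range _, measurableSpace_infPath⟩⟩
  have : Fact ((2 : ℝ≥0∞) ≠ ∞) := ⟨ENNReal.ofNat_ne_top⟩
  exact (isCuntzKrieger_shiftOp hM).exists_rep (not_finiteDimensional_L2 hM)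

theorem existsUnique_isStandardRep {M ν : Measure flipGraph.InfPath}
    (hM : flipGraph.IsPerronFrobeniusMeasure M) [IsProbabilityMeasure ν]
    (h1 : ν ≪ M) (h2 : M ≪ ν) : ∃! π, flipGraph.IsStandardRep ν π := by
  obtain ⟨U, hU⟩ := exists_unitary_isStandardRep_iff hM h1 h2
  obtain ⟨π, hπ⟩ := exists_shiftRep hM
  refine ⟨(U.symm.conjStarAlgEquiv : _ →⋆ₙₐ[ℂ] _).comp π, (hU _).2 fun a => ?_, fun π' hπ' => ?_⟩
  · exact congrArg U.symm.conjStarAlgEquiv (hπ a)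
  · refine hom_ext_gen fun a => ((hU π').1 hπ' a).trans ?_
    exact (congrArg U.symm.conjStarAlgEquiv (hπ a)).symm

theorem unitarilyEquivalent_of_isStandardRep {M ν ν' : Measure flipGraph.InfPath}
    (hM : flipGraph.IsPerronFrobeniusMeasure M) [IsProbabilityMeasure ν]
    [IsProbabilityMeasure ν'] (h1 : ν ≪ M) (h2 : M ≪ ν) (h1' : ν' ≪ M) (h2' : M ≪ ν')
    {π : flipGraph.cstar →⋆ₙₐ[ℂ] (Lp ℂ 2 ν →L[ℂ] Lp ℂ 2 ν)}
    {π' : flipGraph.cstar →⋆ₙₐ[ℂ] (Lp ℂ 2 ν' →L[ℂ] Lp ℂ 2 ν')}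
    (hπ : flipGraph.IsStandardRep ν π) (hπ' : flipGraph.IsStandardRep ν' π') :
    UnitarilyEquivalent π π' := by
  obtain ⟨U, hU⟩ := exists_unitary_isStandardRep_iff hM h1 h2
  obtain ⟨U', hU'⟩ := exists_unitary_isStandardRep_iff hM h1' h2'
  -- Both representations are conjugate to the same operators on `L²(M)`, so passing through `L²(M)`
  -- intertwines them on generators, and hence everywhere.
  let V := U.trans U'.symm
  refine ⟨V, ?_⟩
  have e : (V.conjStarAlgEquiv : _ →⋆ₙₐ[ℂ] _).comp π = π' := by
    refine hom_ext_gen fun a => ?_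
    change V.conjStarAlgEquiv (π (flipGraph.gen a)) = _
    rw [(hU π).1 hπ a, (hU' π').1 hπ' a]
    ext1 ξ
    simp [V]
  intro a ξ
  rw [← e]
  change V (π a ξ) = V (π a (V.symm (V ξ)))
  rw [V.symm_apply_apply]

theorem mainTheorem6 (γ : ℕ → ℝ) (hγ : ∀ i, |γ i| < 1 / 2) (hsum : Summable fun i => |γ i|) :
    (∃! μ : Measure flipGraph.InfPath, IsKakutaniMeasure γ μ) ∧
    (∃! M : Measure flipGraph.InfPath, flipGraph.IsPerronFrobeniusMeasure M) ∧
    ∀ μ M : Measure flipGraph.InfPath, IsKakutaniMeasure γ μ →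
      flipGraph.IsPerronFrobeniusMeasure M →
      flipGraph.StandardSystem μ ∧ flipGraph.StandardSystem M ∧
      (μ ≪ M ∧ M ≪ μ) ∧
      (∃! π, flipGraph.IsStandardRep μ π) ∧ (∃! πM, flipGraph.IsStandardRep M πM) ∧
      (∀ π πM, flipGraph.IsStandardRep μ π → flipGraph.IsStandardRep M πM →
        UnitarilyEquivalent π πM) ∧
      (∀ (γ' : ℕ → ℝ), (∀ i, |γ' i| < 1 / 2) → (Summable fun i => |γ' i|) →
        ∀ μ' : Measure flipGraph.InfPath, IsKakutaniMeasure γ' μ' →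
        ∀ π π', flipGraph.IsStandardRep μ π → flipGraph.IsStandardRep μ' π' →
          UnitarilyEquivalent π π') := by
  refine ⟨existsUnique_isKakutaniMeasure hγ, existsUnique_isPerronFrobeniusMeasure,
    fun μ M hμ hM => ?_⟩
  have := hμ.probability
  have : IsProbabilityMeasure M := ((isPerronFrobeniusMeasure_iff M).1 hM).isProbabilityMeasure
  obtain ⟨h1, h2⟩ := kakutani_equivalent hγ hsum hμ hM
  have hr := Measure.AbsolutelyContinuous.refl M
  refine ⟨standardSystem_of_equivalent hM h1 h2, standardSystem_of_equivalent hM hr hr, ⟨h1, h2⟩,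
    existsUnique_isStandardRep hM h1 h2, existsUnique_isStandardRep hM hr hr,
    fun π πM hπ hπM => unitarilyEquivalent_of_isStandardRep hM h1 h2 hr hr hπ hπM,
    fun γ' hγ' hsum' μ' hμ' π π' hπ hπ' => ?_⟩
  have := hμ'.probability
  obtain ⟨h1', h2'⟩ := kakutani_equivalent hγ' hsum' hμ' hM
  exact unitarilyEquivalent_of_isStandardRep hM h1 h2 h1' h2' hπ hπ'
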